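/- Notation. Let $\Delta=\{|z|<1\}\subset\mathbb C$, $\mathbb S^1=\{|w|=1\}$, and for $0<\varepsilon<1$ let $$H_\varepsilon=\{(z,w)\in\mathbb C^2:\ |z|<\varepsilon,\ |w|<1+\varepsilon\}\cup\{(z,w)\in\mathbb C^2:\ |z|<1+\varepsilon,\ 1-\varepsilon<|w|<1+\varepsilon\}$$ be the thick Hartogs figure. If $\pi:X\to\Delta$ is a holomorphic submersion of a complex surface, with fibers $X_z=\pi^{-1}(z)$, a holomorphic map $f:H_\varepsilon\to X$ is called foliated if there is a holomorphic function $\zeta:\{|z|<1+\varepsilon\}\to\Delta$ with $\pi(f(z,w))=\zeta(z)$ on $H_\varepsilon$. Homology is singular homology with integer coefficients. A curve bounds a disk in $X_z$ if it is the boundary of an embedded closed disk contained in $X_z$. Theorem. There exist a connected complex surface $X$ (a Hausdorff, second countable complex manifold of dimension $2$) and a holomorphic submersion $\pi$ of $X$ onto the unit disk $\Delta$ such that the following hold. 1) Every fiber $X_z$, $z\in\Delta$, is biholomorphic to the unit disk with finitely many (possibly no) punctures. 2) The fiber $X_0$ is biholomorphic to the punctured disk $\Delta\setminus\{0\}$.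 The set $U\subset\Delta$ of those $z$ for which $X_z$ is biholomorphic to $\Delta$ is nonempty and open, and $0\in\partial U$. 3) For every simple closed curve $\gamma_0:\mathbb S^1\to X_0$ around the puncture of $X_0$, every $a\in U$ and every $\varepsilon\in(0,1)$ there is no foliated holomorphic map $f:H_\varepsilon\to X$ such that $f(\{0\}\times\Delta)\subset X_a$, $f(\{1\}\times\mathbb S^1)\subset X_0$, and the loop $s\mapsto f(1,s)$ is homologous to $\gamma_0$ in $X_0$. 4) There is a smooth family $\{\gamma_z\}_{z\in\Delta}$ of smoothly embedded circles $\gamma_z:\mathbb S^1\to X_z$ such that $\gamma_0$ goes around the puncture of $X_0$ and does not bound a disk in $X_0$, and $\gamma_z$ bounds a disk in $X_z$ for every $z\in U$ (hence for points $z$ arbitrarily close to $0$), but for which no $\varepsilon\in(0,1)$, $a\in\Delta$ and foliated holomorphic map $f:H_\varepsilon\to X$ (in particular no foliated holomorphic imbedding) satisfy all of the following: $f(\{0\}\times\Delta)\subset X_a$; the loop $s\mapsto f(0,s)$ is homologous to $\gamma_a$ in $X_a$; $f(\{1\}\times\mathbb S^1)\subset X_0$; and the loop $s\mapsto f(1,s)$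 is homologous to $\gamma_0$ in $X_0$. -/

import Mathlib

open Set Metric
open scoped Manifold ContDiff

/-- The thick Hartogs figure
`H_ε = {|z| < ε, |w| < 1 + ε} ∪ {|z| < 1 + ε, 1 - ε < |w| < 1 + ε}` in `ℂ²`. -/
def hartogsFigure (ε : ℝ) : Set (ℂ × ℂ) :=
  {p | ‖p.1‖ < ε ∧ ‖p.2‖ < 1 + ε} ∪ {p | ‖p.1‖ < 1 + ε ∧ 1 - ε < ‖p.2‖ ∧ ‖p.2‖ < 1 + ε}

section Homology

variable {Y : Type*} [TopologicalSpace Y]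

/-- Singular `n`-chains of `Y` with integer coefficients. -/
abbrev SingularChain (Y : Type*) [TopologicalSpace Y] (n : ℕ) : Type _ :=
  C(stdSimplex ℝ (Fin (n + 1)), Y) →₀ ℤ

/-- The inclusion of the `i`-th face of the standard `(n+1)`-simplex. -/
noncomputable def faceInclusion {n : ℕ} (i : Fin (n + 2)) :
    C(stdSimplex ℝ (Fin (n + 1)), stdSimplex ℝ (Fin (n + 2))) :=
  ⟨stdSimplex.map i.succAbove, stdSimplex.continuous_map _⟩

/-- The boundary of a singular chain: the `ℤ`-linear extension of
`σ ↦ ∑ i, (-1) ^ i • (σ ∘ i-th face)`. -/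
noncomputable def singularBoundary {n : ℕ} (c : SingularChain Y (n + 1)) : SingularChain Y n :=
  c.sum fun σ m => ∑ i : Fin (n + 2), Finsupp.single (σ.comp (faceInclusion i)) ((-1) ^ (i : ℕ) * m)

/-- The singular `1`-simplex `t ↦ γ (exp (2πit))` defined by a loop `γ : 𝕊¹ → Y`, where `t` is the
barycentric coordinate at the second vertex. -/
noncomputable def loopSimplex (γ : C(Circle, Y)) : C(stdSimplex ℝ (Fin 2), Y) where
  toFun x := γ (Circle.exp (2 * Real.pi * x 1))
  continuous_toFun := by
    refine γ.continuous.comp (Circle.exp.continuous.comp (continuous_const.mul ?_))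
    exact (continuous_apply (1 : Fin 2)).comp continuous_subtype_val

/-- Two loops in `Y` are homologous: the difference of their singular `1`-cycles is the boundary of
a singular `2`-chain of `Y`. -/
def Homologous (γ γ' : C(Circle, Y)) : Prop :=
  ∃ c : SingularChain Y 2,
    singularBoundary c = Finsupp.single (loopSimplex γ) 1 - Finsupp.single (loopSimplex γ') 1

end Homology

section Topology

variable {X : Type*} [TopologicalSpace X]

/-- Two maps `γ, γ' : 𝕊¹ → X` are loops in the subspace `Y` of `X` which are homologous in `Y`. -/
def HomologousIn (Y : Set X) (γ γ' : Circle → X) : Prop :=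
  ∃ g g' : C(Circle, Y), (∀ s, (g s : X) = γ s) ∧ (∀ s, (g' s : X) = γ' s) ∧ Homologous g g'

/-- The curve `γ` bounds a disk in the subspace `Y`: its image is the boundary circle of an
(injectively, continuously) embedded closed disk lying in `Y`. -/
def BoundsDisk (Y : Set X) (γ : Circle → X) : Prop :=
  ∃ D : ℂ → X, ContinuousOn D (closedBall 0 1) ∧ InjOn D (closedBall 0 1) ∧
    MapsTo D (closedBall 0 1) Y ∧ D '' sphere 0 1 = range γ

end Topology

section Surface

variable {X : Type*} [TopologicalSpace X] [ChartedSpace (ℂ × ℂ) X]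

/-- `φ` maps the open set `Ω ⊆ ℂ` biholomorphically onto the curve `Y` in the complex surface `X`:
it is a holomorphic immersion of `Ω` and a homeomorphism from `Ω` onto the subspace `Y`. -/
structure IsBiholomorphicOnto (φ : ℂ → X) (Ω : Set ℂ) (Y : Set X) : Prop where
  holomorphic : MDifferentiableOn 𝓘(ℂ, ℂ) 𝓘(ℂ, ℂ × ℂ) φ Ω
  immersion : ∀ w ∈ Ω, Function.Injective (mfderiv 𝓘(ℂ, ℂ) 𝓘(ℂ, ℂ × ℂ) φ w)
  embedding : Topology.IsEmbedding (Ω.domRestrict φ)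
  image_eq : φ '' Ω = Y

/-- The curve `Y` in `X` is (biholomorphic to) the unit disk. -/
def IsDisk (Y : Set X) : Prop :=
  ∃ φ : ℂ → X, IsBiholomorphicOnto φ (ball 0 1) Y

/-- The curve `Y` in `X` is (biholomorphic to) the punctured unit disk. -/
def IsPuncturedDisk (Y : Set X) : Prop :=
  ∃ φ : ℂ → X, IsBiholomorphicOnto φ (ball 0 1 \ {0}) Y

/-- The curve `Y` in `X` is (biholomorphic to) the unit disk with finitely many, possibly no,
punctures. -/
def IsDiskWithPunctures (Y : Set X) : Prop :=
  ∃ S : Set ℂ, S.Finite ∧ S ⊆ ball 0 1 ∧ ∃ φ : ℂ → X, IsBiholomorphicOnto φ (ball 0 1 \ S) Y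

/-- `γ` is a circle around the puncture of the punctured disk `Y`: a simple closed curve which, in
a biholomorphic parametrization of `Y` by the punctured unit disk, encloses the origin, that is, the
origin lies in a bounded component of the complement of the curve. -/
def IsCircleAroundPuncture (Y : Set X) (γ : Circle → X) : Prop :=
  Continuous γ ∧ Function.Injective γ ∧
    ∃ φ : ℂ → X, IsBiholomorphicOnto φ (ball 0 1 \ {0}) Y ∧
      ∃ c : Circle → ℂ, (∀ s, c s ∈ ball (0 : ℂ) 1 \ {0} ∧ φ (c s) = γ s) ∧
        Bornology.IsBounded (connectedComponentIn (range c)ᶜ 0)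

/-- `f` is (on `H_ε`) a foliated holomorphic map from the Hartogs figure `H_ε`, fibred over the disk
of radius `1 + ε` by the first coordinate, to `X`, fibred over the unit disk by `π`. -/
def IsFoliatedHolomorphic (π : X → ℂ) (ε : ℝ) (f : ℂ × ℂ → X) : Prop :=
  MDifferentiableOn 𝓘(ℂ, ℂ × ℂ) 𝓘(ℂ, ℂ × ℂ) f (hartogsFigure ε) ∧
    ∃ ζ : ℂ → ℂ, DifferentiableOn ℂ ζ (ball 0 (1 + ε)) ∧ MapsTo ζ (ball 0 (1 + ε)) (ball 0 1) ∧
      ∀ p ∈ hartogsFigure ε, π (f p) = ζ p.1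

/-- `Γ` is a smooth family, indexed by the unit disk, of smoothly embedded circles `γ_z = Γ z` in the
fibers of `π`. -/
def IsSmoothCircleFamily (π : X → ℂ) (Γ : ℂ → Circle → X) : Prop :=
  ContMDiffOn (𝓘(ℝ, ℂ).prod (𝓡 1)) 𝓘(ℝ, ℂ × ℂ) ∞ (fun p : ℂ × Circle => Γ p.1 p.2)
      (ball 0 1 ×ˢ univ) ∧
    ∀ z ∈ ball (0 : ℂ) 1, (∀ s, π (Γ z s) = z) ∧ Function.Injective (Γ z) ∧
      ∀ s, Function.Injective (mfderiv (𝓡 1) 𝓘(ℝ, ℂ × ℂ) (Γ z) s)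

/-- The set of points of the unit disk over which the fiber of `π` is a disk. -/
def diskLocus (π : X → ℂ) : Set ℂ :=
  {z | z ∈ ball (0 : ℂ) 1 ∧ IsDisk (π ⁻¹' {z})}

end Surface

/-! Write Φ for `wildFun`: it is continuous on ℂ, holomorphic on the open upper half plane, and
fails a Lipschitz condition in the real direction at every point of the closed lower half plane. The
surface is the bidisk in (z, w) with the set {w = 0, Im z ≤ 0} removed. Its holomorphic functions
are generated locally by z and w² − Φ(z), together with w over Im z > 0. Where Im z ≤ 0 one has w ≠
0, so w is a local root of a holomorphic function plus Φ(z). On each fiber Φ(z) is constant and w is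
a holomorphic coordinate: the fiber is a disk over Im z > 0 and a punctured disk elsewhere.

Let f be a foliated map over ζ with Im ζ(0) > 0 and ζ(1) = 0. Put g = w ∘ f and h = g² − Φ ∘ ζ. Then
h is holomorphic, and its slices extend from the annulus to the disk for every z, by Hartogs. The
slices of g extend for z near 0. The claim is that they extend for all z, which is an
open-and-closed argument (`IsFoliatedRoot.mem_extensionDomain`). Extension passes to limits, because
it is an identity between the Cauchy integral and g. Where Im ζ > 0, g is holomorphic and Hartogs
applies. Where Im ζ ≤ 0 and the extended slice has no zero, nearby slices are obtained as square
roots (`eventually_extendsAt`). If the extended slice has a zero, Φ ∘ ζ must be Lipschitz on the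
nearby z whose slices extend (`exists_lipschitz`), which contradicts the wildness of Φ.

The same contradiction shows that the extended slice over z = 1 has no zero. Hence w has a
continuous logarithm along f(1, ·) (`IsFoliatedRoot.hasLog`). Having such a logarithm is a homology
invariant in the punctured disk X₀ (`HomologousIn.hasLog_iff`), and a circle around the puncture has
none.

The circles of part 4 are given by w² − Φ(z) = s²/4, so they are smooth although Φ is not. If Im a >
0 the previous argument applies; if Im a ≤ 0 the disk f(0, ·) avoids w = 0, so its boundary cannot
be homologous to γ_a. -/

/-! ### Continuous logarithms of plane loops. -/

section Logarithms

/-- A nowhere vanishing continuous function on a convex set has a continuous logarithm. -/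
theorem Convex.exists_continuous_log {E : Type*} [AddCommGroup E] [Module ℝ E] [TopologicalSpace E]
    [IsTopologicalAddGroup E] [ContinuousSMul ℝ E] {s : Set E} (hs : Convex ℝ s)
    {f : s → ℂ} (hf : Continuous f) (h0 : ∀ x, f x ≠ 0) :
    ∃ l : s → ℂ, Continuous l ∧ ∀ x, Complex.exp (l x) = f x := by
  classical
  by_cases hne : Nonempty s
  swap
  · exact ⟨f, hf, fun x => (hne ⟨x⟩).elim⟩
  obtain ⟨a⟩ := hne
  -- `q` contracts `s` to `a`; the resulting homotopy from the constant `f a` to `f` is lifted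
  -- through the covering `exp`, and its end is the logarithm.
  let q : unitInterval × s → s := fun p =>
    ⟨(1 - (p.1 : ℝ)) • (a : E) + (p.1 : ℝ) • (p.2 : E),
      hs a.2 p.2.2 (by linarith [p.1.2.2]) p.1.2.1 (by ring)⟩
  have hq : Continuous q := by
    refine Continuous.subtype_mk ?_ _
    fun_prop
  let H : C(unitInterval × s, {z : ℂ // z ≠ 0}) :=
    ⟨fun p => ⟨f (q p), h0 _⟩, Continuous.subtype_mk (hf.comp hq) _⟩
  have H0 : ∀ x : s, H (0, x) =
      (⟨_, Complex.exp_ne_zero ((ContinuousMap.const s (Complex.log (f a))) x)⟩ : {z : ℂ // z ≠ 0}) := by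
    intro x
    have : q (0, x) = a := by ext; simp [q]
    ext
    simp [H, this, Complex.exp_log (h0 a)]
  let L := Complex.isCoveringMap_exp.liftHomotopy H (ContinuousMap.const s (Complex.log (f a))) H0
  refine ⟨fun x => L (1, x), L.continuous.comp (by fun_prop), fun x => ?_⟩
  have h1 := congr_fun (Complex.isCoveringMap_exp.liftHomotopy_lifts (H := H)
    (f := ContinuousMap.const s (Complex.log (f a))) H0) (1, x)
  have h2 : q (1, x) = x := by ext; simp [q]
  have h3 : Complex.exp (L (1, x)) = f (q (1, x)) := congr_arg Subtype.val h1
  rwa [h2] at h3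

theorem Convex.exists_continuousOn_log {E : Type*} [AddCommGroup E] [Module ℝ E]
    [TopologicalSpace E] [IsTopologicalAddGroup E] [ContinuousSMul ℝ E] {s : Set E}
    (hs : Convex ℝ s) {f : E → ℂ} (hf : ContinuousOn f s) (h0 : ∀ x ∈ s, f x ≠ 0) :
    ∃ l : E → ℂ, ContinuousOn l s ∧ ∀ x ∈ s, Complex.exp (l x) = f x := by
  classical
  obtain ⟨l, hl, hle⟩ := hs.exists_continuous_log (f := s.domRestrict f)
    (continuousOn_iff_continuous_domRestrict.1 hf) (fun x => h0 x x.2)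
  refine ⟨fun x => if h : x ∈ s then l ⟨x, h⟩ else 0, ?_, ?_⟩
  · rw [continuousOn_iff_continuous_domRestrict]
    convert hl using 1
    ext x
    simp
  · intro x hx
    simpa [hx] using hle ⟨x, hx⟩

/-- A continuous function with values in the periods of `exp` is constant. -/
theorem eq_of_exp_eq_one {A : Type*} [TopologicalSpace A] [PreconnectedSpace A] {d : A → ℂ}
    (hd : Continuous d) (h1 : ∀ a, Complex.exp (d a) = 1) (a b : A) : d a = d b := by
  have hmem : ∀ a, ∃ n : ℤ, d a = n * (2 * Real.pi * Complex.I) := fun a =>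
    Complex.exp_eq_one_iff.1 (h1 a)
  choose n hn using hmem
  have hpi : (2 * Real.pi : ℂ) ≠ 0 := by
    norm_cast; exact (by positivity : (2 * Real.pi : ℝ) ≠ 0)
  have hnc : Continuous n := by
    have hc : Continuous fun a => ((n a : ℤ) : ℝ) := by
      have : (fun a => ((n a : ℤ) : ℝ)) = fun a => (d a / (2 * Real.pi * Complex.I)).re := by
        ext a
        rw [hn a, mul_div_cancel_right₀ _ (mul_ne_zero hpi Complex.I_ne_zero)]
        simp
      rw [this]
      exact Complex.continuous_re.comp (hd.div_const _)
    exact (Int.isClosedEmbedding_coe_real.isEmbedding.continuous_iff).2 hc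
  rw [hn a, hn b, PreconnectedSpace.constant inferInstance hnc]

/-- The loop `γ` in the plane has a continuous logarithm. -/
def HasLog (γ : Circle → ℂ) : Prop :=
  ∃ l : Circle → ℂ, Continuous l ∧ ∀ s, Complex.exp (l s) = γ s

/-- Along `Circle.exp θ` a logarithm would differ from iθ by a constant, yet take equal values at θ
= 0 and θ = 2π. -/
theorem not_hasLog_coe : ¬ HasLog (fun s => (s : ℂ)) := by
  rintro ⟨l, hl, he⟩
  have h := eq_of_exp_eq_one (d := fun θ : ℝ => l (Circle.exp θ) - θ * Complex.I)
    (by fun_prop) (fun θ => by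
      rw [Complex.exp_sub, he]
      simp only [Circle.coe_exp]
      rw [div_self (Complex.exp_ne_zero _)]) 0 (2 * Real.pi)
  simp only [Circle.exp_two_pi, Circle.exp_zero] at h
  push_cast at h
  have : (Real.pi : ℂ) = 0 := by
    have h2 : (Real.pi : ℂ) * Complex.I = 0 := by linear_combination h / 2
    exact (mul_eq_zero.1 h2).resolve_right Complex.I_ne_zero
  exact Real.pi_ne_zero (by exact_mod_cast this)

theorem HasLog.div {γ δ : Circle → ℂ} (h : HasLog γ) (h' : HasLog δ) :
    HasLog (fun s => γ s / δ s) := by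
  obtain ⟨l, hl, he⟩ := h
  obtain ⟨m, hm, hf⟩ := h'
  exact ⟨fun s => l s - m s, hl.sub hm, fun s => by rw [Complex.exp_sub, he, hf]⟩

theorem hasLog_of_mem_slitPlane {γ : Circle → ℂ} (hγ : Continuous γ)
    (h : ∀ s, γ s ∈ Complex.slitPlane) : HasLog γ :=
  ⟨fun s => Complex.log (γ s), hγ.clog h,
    fun s => Complex.exp_log (Complex.slitPlane_ne_zero (h s))⟩

/-- The boundary values of a nowhere vanishing continuous function on the closed unit disk have a
continuous logarithm. -/
theorem hasLog_of_closedBall {F : ℂ → ℂ} (hF : ContinuousOn F (closedBall 0 1))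
    (h0 : ∀ w ∈ closedBall (0 : ℂ) 1, F w ≠ 0) : HasLog (fun s => F s) := by
  obtain ⟨l, hl, he⟩ := (convex_closedBall (0 : ℂ) 1).exists_continuousOn_log hF h0
  have hmem : ∀ s : Circle, (s : ℂ) ∈ closedBall (0 : ℂ) 1 := fun s => by
    simp [Circle.norm_coe]
  exact ⟨fun s => l s, hl.comp_continuous (by fun_prop) hmem, fun s => he _ (hmem s)⟩

/-- Removing a compact set that carries a continuous logarithm of the identity does not separate the
origin from infinity. -/
theorem not_isBounded_of_log {K : Set ℂ} (hK : IsCompact K) (h0 : (0 : ℂ) ∉ K) {l : K → ℂ}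
    (hl : Continuous l) (he : ∀ z : K, Complex.exp (l z) = z) :
    ¬ Bornology.IsBounded (connectedComponentIn Kᶜ 0) := by
  classical
  intro hb
  set V := connectedComponentIn Kᶜ (0 : ℂ) with hV
  have hVo : IsOpen V := hK.isClosed.isOpen_compl.connectedComponentIn
  have hVK : V ⊆ Kᶜ := connectedComponentIn_subset _ _
  have h0V : (0 : ℂ) ∈ V := mem_connectedComponentIn h0
  have hfr : frontier V ⊆ K := by
    intro z hz
    by_contra hzK
    have hzc : z ∈ Kᶜ := hzK
    have hzV : z ∉ V := by
      intro h; rw [hVo.frontier_eq] at hz; exact hz.2 h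
    have ho : IsOpen (connectedComponentIn Kᶜ z) := hK.isClosed.isOpen_compl.connectedComponentIn
    obtain ⟨y, hy1, hy2⟩ := mem_closure_iff.1 (frontier_subset_closure hz) _ ho
      (mem_connectedComponentIn hzc)
    have e1 := connectedComponentIn_eq hy1
    have e2 := connectedComponentIn_eq hy2
    apply hzV
    rw [hV, e2, ← e1]
    exact mem_connectedComponentIn hzc
  -- Tietze extension of the logarithm from `K` to the plane.
  obtain ⟨L, hL⟩ := ContinuousMap.exists_extension' (hK.isClosed.isClosedEmbedding_subtypeVal)
    (⟨l, hl⟩ : C(K, ℂ))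
  have hLe : ∀ z ∈ K, Complex.exp (L z) = z := by
    intro z hz
    have := congr_fun hL ⟨z, hz⟩
    simp only [Function.comp_apply, ContinuousMap.coe_mk] at this
    rw [this, he]
  obtain ⟨R, hR⟩ := hb.subset_ball (0 : ℂ)
  have hRpos : 0 < R := by simpa using hR h0V
  -- The two pieces agree on the frontier of `V`, which lies in `K`, and `q` has no zero because 0
  -- lies in `V`. Being the identity on the circle of radius `R`, `q` would give a logarithm of the
  -- identity there.
  let q : ℂ → ℂ := fun z => if z ∈ V then Complex.exp (L z) else z
  have hq : Continuous q := by
    refine continuous_if (fun z hz => hLe z (hfr hz)) (by fun_prop) continuous_id.continuousOn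
  have hq0 : ∀ z, q z ≠ 0 := by
    intro z
    by_cases hz : z ∈ V
    · simp [q, hz, Complex.exp_ne_zero]
    · simp only [q, hz, if_false]
      rintro rfl
      exact hz h0V
  have hlog : HasLog (fun s => q (R * (s : ℂ))) :=
    hasLog_of_closedBall (F := fun w => q (R * w)) (by fun_prop) (fun w _ => hq0 _)
  have hR1 : HasLog (fun _ => (R : ℂ)) :=
    ⟨fun _ => Real.log R, by fun_prop, fun _ => by
      rw [← Complex.ofReal_exp, Real.exp_log hRpos]⟩
  refine not_hasLog_coe ?_
  convert hlog.div hR1 using 1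
  ext s
  have hs : (R * (s : ℂ)) ∉ V := fun h => by
    have := hR h
    simp [abs_of_pos hRpos, Circle.norm_coe] at this
  have : (R : ℂ) ≠ 0 := by exact_mod_cast hRpos.ne'
  simp only [q, hs, if_false]
  field_simp

/-- An injective loop in the punctured plane which encloses the origin has no logarithm. -/
theorem not_hasLog_of_isBounded {c : Circle → ℂ} (hc : Continuous c) (hi : Function.Injective c)
    (h0 : ∀ s, c s ≠ 0) (hb : Bornology.IsBounded (connectedComponentIn (range c)ᶜ 0)) :
    ¬ HasLog c := by
  rintro ⟨l, hl, he⟩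
  have hemb : Topology.IsEmbedding c := (hc.isClosedEmbedding hi).isEmbedding
  refine not_isBounded_of_log (isCompact_range hc) (by rintro ⟨s, hs⟩; exact h0 s hs)
    (l := fun z => l (hemb.toHomeomorph.symm z)) (hl.comp (Homeomorph.continuous _)) ?_ hb
  intro z
  rw [he]
  exact congr_arg Subtype.val (hemb.toHomeomorph.apply_symm_apply z)

end Logarithms

/-! ### Homology invariance of the existence of a logarithm. -/

section Homology

variable {Y : Type*} [TopologicalSpace Y]

/-- The increment of a continuous logarithm of `w` along a singular `1`-simplex. -/
noncomputable def logIncrement (w : Y → ℂ) (σ : C(stdSimplex ℝ (Fin 2), Y)) : ℂ :=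
  open scoped Classical in
  if h : ∃ l : stdSimplex ℝ (Fin 2) → ℂ, Continuous l ∧ ∀ x, Complex.exp (l x) = w (σ x) then
    h.choose (stdSimplex.vertex 1) - h.choose (stdSimplex.vertex 0) else 0

instance stdSimplex.preconnectedSpace (n : ℕ) :
    PreconnectedSpace (stdSimplex ℝ (Fin (n + 1))) :=
  Subtype.preconnectedSpace (convex_stdSimplex ℝ (Fin (n + 1))).isPreconnected

theorem logIncrement_eq {w : Y → ℂ} {σ : C(stdSimplex ℝ (Fin 2), Y)}
    {l : stdSimplex ℝ (Fin 2) → ℂ} (hl : Continuous l) (he : ∀ x, Complex.exp (l x) = w (σ x)) :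
    logIncrement w σ = l (stdSimplex.vertex 1) - l (stdSimplex.vertex 0) := by
  have h : ∃ l : stdSimplex ℝ (Fin 2) → ℂ, Continuous l ∧ ∀ x, Complex.exp (l x) = w (σ x) :=
    ⟨l, hl, he⟩
  rw [logIncrement, dif_pos h]
  have hc := h.choose_spec
  have := eq_of_exp_eq_one (d := fun x => h.choose x - l x) (hc.1.sub hl)
    (fun x => by rw [Complex.exp_sub, hc.2, he, div_self]; rw [← he]; exact Complex.exp_ne_zero _)
    (stdSimplex.vertex 1) (stdSimplex.vertex 0)
  linear_combination this

/-- The logarithm exists on the whole convex 2-simplex, so the increments along its three faces are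
differences of vertex values and cancel. -/
theorem logIncrement_boundary {w : Y → ℂ} (hw : Continuous w) (h0 : ∀ y, w y ≠ 0)
    (c : SingularChain Y 2) :
    Finsupp.linearCombination ℤ (logIncrement w) (singularBoundary c) = 0 := by
  rw [singularBoundary, Finsupp.sum, map_sum]
  refine Finset.sum_eq_zero fun σ _ => ?_
  obtain ⟨L, hL, he⟩ := (convex_stdSimplex ℝ (Fin 3)).exists_continuous_log
    (f := fun x => w (σ x)) (hw.comp σ.continuous) (fun x => h0 _)
  have key : ∀ i : Fin 3, logIncrement w (σ.comp (faceInclusion i)) =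
      L (stdSimplex.vertex (i.succAbove 1)) - L (stdSimplex.vertex (i.succAbove 0)) := by
    intro i
    have := logIncrement_eq (w := w) (σ := σ.comp (faceInclusion i))
      (l := fun x => L (faceInclusion i x)) (hL.comp (faceInclusion i).continuous) (fun x => he _)
    simpa [faceInclusion, stdSimplex.map_vertex] using this
  rw [map_sum]
  simp only [Finsupp.linearCombination_single, Fin.sum_univ_succ, key]
  simp [Fin.succAbove, Fin.lt_def]
  ring

/-- A logarithm along the unrolled loop is 2π-periodic exactly when its increment over one turn
vanishes; it then descends through the quotient map `Circle.exp`. -/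
theorem logIncrement_loopSimplex_eq_zero_iff {w : Y → ℂ} (hw : Continuous w) (h0 : ∀ y, w y ≠ 0)
    (γ : C(Circle, Y)) : logIncrement w (loopSimplex γ) = 0 ↔ HasLog (fun s => w (γ s)) := by
  constructor
  · intro h
    obtain ⟨L, hL, he⟩ := (convex_univ (𝕜 := ℝ) (E := ℝ)).exists_continuousOn_log
      (f := fun θ => w (γ (Circle.exp θ))) (by fun_prop) (fun x _ => h0 _)
    rw [continuousOn_univ] at hL
    have h1 := logIncrement_eq (w := w) (σ := loopSimplex γ)
      (l := fun x => L (2 * Real.pi * x 1))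
      (hL.comp (continuous_const.mul ((continuous_apply (1 : Fin 2)).comp continuous_subtype_val)))
      (fun x => he _ (mem_univ _))
    rw [h] at h1
    have h2 : L (2 * Real.pi) = L 0 := by
      have h3 : 0 = L (2 * Real.pi) - L 0 := by simpa using h1
      linear_combination -h3
    have hper : ∀ θ, L (θ + 2 * Real.pi) = L θ := by
      intro θ
      have := eq_of_exp_eq_one (d := fun θ : ℝ => L (θ + 2 * Real.pi) - L θ) (by fun_prop)
        (fun θ => by
          rw [Complex.exp_sub, he _ (mem_univ _), he _ (mem_univ _), Circle.exp_add,
            Circle.exp_two_pi, mul_one, div_self (h0 _)]) θ 0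
      simp only [zero_add, h2, sub_self] at this
      exact sub_eq_zero.1 this
    have hp : Function.Periodic L (2 * Real.pi) := hper
    have harg : ∀ s : Circle, Complex.exp (L (Complex.arg s)) = w (γ s) := fun s => by
      rw [he _ (mem_univ _), Circle.exp_arg]
    refine ⟨fun s => L (Complex.arg s), ?_, harg⟩
    have hlc : ∀ θ : ℝ, L (Complex.arg (Circle.exp θ)) = L θ := by
      intro θ
      obtain ⟨m, hm⟩ := Circle.exp_eq_exp.1 (Circle.exp_arg (Circle.exp θ))
      rw [hm]
      have := hp.int_mul m θ
      simpa using this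
    have hquot : Topology.IsQuotientMap (Circle.exp : ℝ → Circle) := by
      exact Circle.isCoveringMap_exp.isQuotientMap (fun s => ⟨_, Circle.exp_arg s⟩)
    rw [hquot.continuous_iff]
    convert hL using 1
    ext θ
    exact hlc θ
  · rintro ⟨l, hl, he⟩
    rw [logIncrement_eq (l := fun x => l (Circle.exp (2 * Real.pi * x 1)))
      (hl.comp (Circle.exp.continuous.comp (continuous_const.mul
        ((continuous_apply (1 : Fin 2)).comp continuous_subtype_val)))) (fun x => he _)]
    simp

theorem Homologous.hasLog_iff {γ γ' : C(Circle, Y)} (h : Homologous γ γ') {w : Y → ℂ}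
    (hw : Continuous w) (h0 : ∀ y, w y ≠ 0) :
    HasLog (fun s => w (γ s)) ↔ HasLog (fun s => w (γ' s)) := by
  obtain ⟨c, hc⟩ := h
  have := logIncrement_boundary hw h0 c
  rw [hc, map_sub, Finsupp.linearCombination_single, Finsupp.linearCombination_single,
    one_smul, one_smul, sub_eq_zero] at this
  rw [← logIncrement_loopSimplex_eq_zero_iff hw h0, ← logIncrement_loopSimplex_eq_zero_iff hw h0,
    this]

theorem HomologousIn.hasLog_iff {X : Type*} [TopologicalSpace X] {Y : Set X} {γ γ' : Circle → X}
    (h : HomologousIn Y γ γ') {w : X → ℂ} (hw : ContinuousOn w Y) (h0 : ∀ y ∈ Y, w y ≠ 0) :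
    HasLog (fun s => w (γ s)) ↔ HasLog (fun s => w (γ' s)) := by
  obtain ⟨g, g', hg, hg', hh⟩ := h
  have := hh.hasLog_iff (w := Y.domRestrict w) (continuousOn_iff_continuous_domRestrict.1 hw)
    (fun y => h0 y y.2)
  simpa [domRestrict, hg, hg'] using this

end Homology

/-! ### The wild function: a lacunary series and its failure to be Lipschitz. -/

section LacunarySeries

/-- The nearest-point projection of the plane to the closed upper half plane. -/
def upperProj (z : ℂ) : ℂ := ⟨z.re, max z.im 0⟩

theorem continuous_upperProj : Continuous upperProj := by
  have : upperProj = fun z : ℂ => ((z.re : ℝ) : ℂ) + ((max z.im 0 : ℝ) : ℂ) * Complex.I := by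
    ext z
    apply Complex.ext <;> simp [upperProj]
  rw [this]
  fun_prop

theorem upperProj_im_nonneg (z : ℂ) : 0 ≤ (upperProj z).im := le_max_right _ _

theorem upperProj_of_im_pos {z : ℂ} (hz : 0 < z.im) : upperProj z = z := by
  apply Complex.ext <;> simp [upperProj, hz.le]

/-- The terms of a lacunary series which converges in the closed upper half plane. -/
noncomputable def lacunaryTerm (n : ℕ) (z : ℂ) : ℂ :=
  (1 / 2) ^ n * (Complex.exp ((16 ^ n : ℝ) * z * Complex.I) - 1)

theorem norm_lacunaryTerm_le (n : ℕ) {z : ℂ} (hz : 0 ≤ z.im) :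
    ‖lacunaryTerm n z‖ ≤ 2 * (1 / 2) ^ n := by
  have h1 : ‖Complex.exp ((16 ^ n : ℝ) * z * Complex.I)‖ ≤ 1 := by
    rw [Complex.norm_exp]
    simp only [Complex.mul_re, Complex.mul_im, Complex.ofReal_re, Complex.ofReal_im,
      Complex.I_re, Complex.I_im, zero_mul, sub_zero, mul_zero, mul_one, add_zero, zero_sub]
    rw [Real.exp_le_one_iff]
    have : 0 ≤ (16 : ℝ) ^ n * z.im := by positivity
    linarith
  have h2 : ‖Complex.exp ((16 ^ n : ℝ) * z * Complex.I) - 1‖ ≤ 2 :=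
    (norm_sub_le _ _).trans (by simp only [norm_one]; linarith)
  rw [lacunaryTerm, norm_mul, norm_pow]
  have h3 : ‖(1 / 2 : ℂ)‖ = 1 / 2 := by norm_num
  rw [h3, mul_comm]
  gcongr

theorem summable_lacunary_bound : Summable fun n : ℕ => (2 : ℝ) * (1 / 2) ^ n :=
  (summable_geometric_of_lt_one (by norm_num) (by norm_num)).mul_left 2

/-- A continuous function which is holomorphic in the upper half plane and oscillates at every point
outside of it. -/
noncomputable def wildFun (z : ℂ) : ℂ := (1 / 128) * ∑' n, lacunaryTerm n (upperProj z)

theorem continuous_wildFun : Continuous wildFun := by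
  refine continuous_const.mul (continuous_tsum (fun n => ?_) summable_lacunary_bound
    (fun n z => norm_lacunaryTerm_le n (upperProj_im_nonneg z)))
  have := continuous_upperProj
  unfold lacunaryTerm
  fun_prop

/-- The factor 1/128 in `wildFun` serves this bound, which keeps 1 + 4 Φ(z) t close to 1 when the
circles are built. -/
theorem norm_wildFun_le (z : ℂ) : ‖wildFun z‖ ≤ 1 / 32 := by
  have h := tsum_of_norm_bounded (summable_lacunary_bound.hasSum)
    (fun n => norm_lacunaryTerm_le n (upperProj_im_nonneg z))
  rw [tsum_mul_left, tsum_geometric_of_lt_one (by norm_num) (by norm_num)] at h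
  rw [wildFun, norm_mul]
  norm_num at h ⊢
  linarith

/-- The −1 in `lacunaryTerm` serves this value: it makes the circle over 0 the round one |w| = 1/2.
-/
theorem wildFun_zero : wildFun 0 = 0 := by
  have : upperProj 0 = 0 := by apply Complex.ext <;> simp [upperProj]
  simp [wildFun, this, lacunaryTerm]

theorem differentiableOn_wildFun : DifferentiableOn ℂ wildFun {z | 0 < z.im} := by
  have ho : IsOpen {z : ℂ | 0 < z.im} := isOpen_lt continuous_const Complex.continuous_im
  have h : DifferentiableOn ℂ (fun z => ∑' n, lacunaryTerm n z) {z | 0 < z.im} := by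
    refine Complex.differentiableOn_tsum_of_summable_norm summable_lacunary_bound (fun n => ?_) ho
      (fun n z hz => norm_lacunaryTerm_le n (le_of_lt hz))
    unfold lacunaryTerm
    fun_prop
  refine (h.const_mul (1 / 128)).congr fun z hz => ?_
  rw [wildFun, upperProj_of_im_pos hz]

/-- The step π/16^m reverses the sign of the m-th exponential, which changes its term by 2 · 2⁻ᵐ. It
is a period of all later terms, and the earlier terms together change by at most 2⁻ᵐ. The step is
horizontal because below the real axis `wildFun` depends on the real part only. -/
theorem le_norm_wildFun_sub {p : ℂ} (hp : p.im ≤ 0) (m : ℕ) :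
    (1 / 128) * (1 / 2) ^ m ≤ ‖wildFun (p + (Real.pi / 16 ^ m : ℝ)) - wildFun p‖ := by
  set x := p.re with hx
  have e1 : upperProj p = (x : ℂ) := by
    apply Complex.ext <;> simp [upperProj, hp, hx]
  have e2 : upperProj (p + (Real.pi / 16 ^ m : ℝ)) = ((x + Real.pi / 16 ^ m : ℝ) : ℂ) := by
    apply Complex.ext
    · simp [upperProj, hx, -Complex.ofReal_div]
    · simp [upperProj, hp, -Complex.ofReal_div]
  have hs : ∀ y : ℝ, Summable fun n => lacunaryTerm n (y : ℂ) := fun y =>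
    Summable.of_norm_bounded summable_lacunary_bound
      (fun n => norm_lacunaryTerm_le n (by simp))
  set d : ℕ → ℂ := fun n =>
    lacunaryTerm n ((x + Real.pi / 16 ^ m : ℝ) : ℂ) - lacunaryTerm n (x : ℂ) with hd
  have hdn : ∀ n, d n = (1 / 2) ^ n * (Complex.exp (((16 ^ n * x : ℝ) : ℂ) * Complex.I) *
      (Complex.exp (Complex.I * ((16 ^ n * (Real.pi / 16 ^ m) : ℝ) : ℂ)) - 1)) := by
    intro n
    have : Complex.exp ((16 ^ n : ℝ) * ((x + Real.pi / 16 ^ m : ℝ) : ℂ) * Complex.I) =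
        Complex.exp (((16 ^ n * x : ℝ) : ℂ) * Complex.I) *
          Complex.exp (Complex.I * ((16 ^ n * (Real.pi / 16 ^ m) : ℝ) : ℂ)) := by
      rw [← Complex.exp_add]
      congr 1
      push_cast
      ring
    simp only [hd, lacunaryTerm]
    rw [this]
    push_cast
    ring
  have hnorm : ∀ n, ‖d n‖ = (1 / 2) ^ n *
      ‖Complex.exp (Complex.I * ((16 ^ n * (Real.pi / 16 ^ m) : ℝ) : ℂ)) - 1‖ := by
    intro n
    rw [hdn, norm_mul, norm_mul, Complex.norm_exp_ofReal_mul_I, one_mul, norm_pow]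
    norm_num
  have hbig : ∀ n ∉ Finset.range (m + 1), d n = 0 := by
    intro n hn
    have hmn : m + 1 ≤ n := by simpa using hn
    obtain ⟨k, rfl⟩ := Nat.exists_eq_add_of_le hmn
    rw [hdn]
    have : Complex.exp (Complex.I * ((16 ^ (m + 1 + k) * (Real.pi / 16 ^ m) : ℝ) : ℂ)) = 1 := by
      rw [Complex.exp_eq_one_iff]
      -- 16^(m+1+k) · π/16^m = 16π · 16^k = 8 · 16^k · 2π.
      refine ⟨8 * 16 ^ k, ?_⟩
      have h16 : (16 : ℂ) ^ m ≠ 0 := pow_ne_zero _ (by norm_num)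
      push_cast
      field_simp
      ring
    rw [this]
    simp
  have hm : ‖d m‖ = 2 * (1 / 2) ^ m := by
    rw [hnorm]
    have : (16 : ℝ) ^ m * (Real.pi / 16 ^ m) = Real.pi := by field_simp
    rw [this, mul_comm Complex.I, Complex.exp_pi_mul_I]
    norm_num
    ring
  have hsmall : ‖∑ n ∈ Finset.range m, d n‖ ≤ (1 / 2) ^ m := by
    -- From |e^{ix} − 1| ≤ |x|; the geometric sum of 8ⁿ then gives at most π/7 · 2⁻ᵐ.
    have h1 : ∀ n ∈ Finset.range m, ‖d n‖ ≤ (8 : ℝ) ^ n * (Real.pi / 16 ^ m) := by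
      intro n _
      rw [hnorm]
      have h2 := Real.norm_exp_I_mul_ofReal_sub_one_le (x := 16 ^ n * (Real.pi / 16 ^ m))
      rw [Real.norm_of_nonneg (by positivity)] at h2
      calc (1 / 2 : ℝ) ^ n * _ ≤ (1 / 2) ^ n * (16 ^ n * (Real.pi / 16 ^ m)) := by gcongr
        _ = _ := by rw [← mul_assoc, ← mul_pow]; norm_num
    refine (norm_sum_le_of_le _ h1).trans ?_
    rw [← Finset.sum_mul, geom_sum_eq (by norm_num)]
    have h8 : (0 : ℝ) < 8 ^ m := by positivity
    have hpi : Real.pi ≤ 7 := Real.pi_le_four.trans (by norm_num)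
    have h16 : (16 : ℝ) ^ m = 8 ^ m * 2 ^ m := by rw [← mul_pow]; norm_num
    rw [h16, one_div, inv_pow]
    calc ((8 : ℝ) ^ m - 1) / (8 - 1) * (Real.pi / (8 ^ m * 2 ^ m))
        ≤ (8 : ℝ) ^ m / 7 * (7 / (8 ^ m * 2 ^ m)) := by
          gcongr
          · linarith
          · norm_num
      _ = _ := by field_simp
  have htot : wildFun (p + (Real.pi / 16 ^ m : ℝ)) - wildFun p =
      (1 / 128) * (∑ n ∈ Finset.range m, d n + d m) := by
    rw [wildFun, wildFun, e1, e2, ← mul_sub, ← (hs _).tsum_sub (hs _),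
      tsum_eq_sum hbig, Finset.sum_range_succ]
  rw [htot, norm_mul]
  have h128 : ‖(1 / 128 : ℂ)‖ = 1 / 128 := by norm_num
  rw [h128]
  gcongr
  have := norm_sub_le_norm_add (d m) (∑ n ∈ Finset.range m, d n)
  rw [add_comm (d m)] at this
  linarith

/-- `wildFun` does not satisfy a Lipschitz condition at any point of the closed lower half plane. -/
theorem exists_lt_norm_wildFun_sub {p : ℂ} (hp : p.im ≤ 0) (L δ : ℝ) (hδ : 0 < δ) :
    ∃ t : ℝ, 0 < t ∧ t < δ ∧ L * t < ‖wildFun (p + t) - wildFun p‖ := by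
  have h1 : Filter.Tendsto (fun m : ℕ => Real.pi / (16 : ℝ) ^ m) Filter.atTop (nhds 0) :=
    Filter.Tendsto.const_div_atTop (tendsto_pow_atTop_atTop_of_one_lt (by norm_num)) _
  have h2 : Filter.Tendsto (fun m : ℕ => (8 : ℝ) ^ m) Filter.atTop Filter.atTop :=
    tendsto_pow_atTop_atTop_of_one_lt (by norm_num)
  -- The lower bound divided by the step is 8^m / (128 π), which is unbounded in `m`.
  obtain ⟨m, hm1, hm2⟩ := ((h1.eventually (gt_mem_nhds hδ)).and
    (h2.eventually_gt_atTop (128 * (L * Real.pi)))).exists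
  refine ⟨Real.pi / 16 ^ m, by positivity, hm1, lt_of_lt_of_le ?_ (le_norm_wildFun_sub hp m)⟩
  have h16 : (16 : ℝ) ^ m = 8 ^ m * 2 ^ m := by rw [← mul_pow]; norm_num
  rw [h16, one_div_pow, ← mul_div_assoc, div_lt_iff₀ (by positivity)]
  have : (1 : ℝ) / 128 * (1 / 2 ^ m) * (8 ^ m * 2 ^ m) = 8 ^ m / 128 := by field_simp
  rw [this]
  linarith

end LacunarySeries

/-! ### Extension of slices to the disk by the Cauchy integral. -/

section CauchyTransform

open Complex Filter Topology

/-- The Cauchy integral over the unit circle in the second variable. -/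
noncomputable def cauchyTransform (q : ℂ × ℂ → ℂ) (z s : ℂ) : ℂ :=
  (2 * Real.pi * I : ℂ)⁻¹ • ∮ t in C(0, 1), (t - s)⁻¹ • q (z, t)

/-- The slice `q (z, ·)` extends from the annulus `ρ < |s| ≤ 1` to a holomorphic function on the
unit disk. -/
def ExtendsAt (q : ℂ × ℂ → ℂ) (ρ : ℝ) (z : ℂ) : Prop :=
  ∃ G : ℂ → ℂ, DiffContOnCl ℂ G (ball 0 1) ∧ ∀ s, ρ < ‖s‖ → ‖s‖ ≤ 1 → G s = q (z, s)

variable {q : ℂ × ℂ → ℂ} {ρ : ℝ} {O A : Set ℂ} {z z₀ s : ℂ}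

theorem exists_forall_norm_sub_lt (hO : IsOpen O) {K : Set ℂ} (hK : IsCompact K)
    (hq : ContinuousOn q (O ×ˢ K)) (hz : z₀ ∈ O) {η : ℝ} (hη : 0 < η) :
    ∃ δ > 0, ball z₀ δ ⊆ O ∧ ∀ z ∈ ball z₀ δ, ∀ s ∈ K, ‖q (z, s) - q (z₀, s)‖ < η := by
  obtain ⟨v, hv, h⟩ := hK.mem_uniformity_of_prod (f := fun z s => q (z, s)) hq hz
    (dist_mem_uniformity hη)
  rw [hO.nhdsWithin_eq hz] at hv
  obtain ⟨δ, hδ, hb⟩ := Metric.mem_nhds_iff.1 (inter_mem hv (hO.mem_nhds hz))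
  refine ⟨δ, hδ, fun z hz => (hb hz).2, fun z hz s hs => ?_⟩
  have := h z (hb hz).1 s hs
  rwa [mem_ofPred_eq, dist_eq_norm] at this

theorem sphere_subset_of_annulus (hρ : ρ < 1) (hA : ∀ s, ρ ≤ ‖s‖ → ‖s‖ ≤ 1 → s ∈ A) :
    sphere (0 : ℂ) 1 ⊆ A := fun s hs => by
  have : ‖s‖ = 1 := by simpa using hs
  exact hA s (by linarith) this.le

theorem sub_ne_zero_of_mem_sphere {t s : ℂ} (ht : t ∈ sphere (0 : ℂ) 1) (hs : ‖s‖ < 1) :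
    t - s ≠ 0 := by
  rintro h
  have : ‖t‖ = 1 := by simpa using ht
  rw [sub_eq_zero.1 h] at this
  linarith

theorem norm_inv_sub_le_of_mem_sphere {t s : ℂ} (ht : t ∈ sphere (0 : ℂ) 1) (hs : ‖s‖ < 1) :
    ‖(t - s)⁻¹‖ ≤ (1 - ‖s‖)⁻¹ := by
  have h1 : ‖t‖ = 1 := by simpa using ht
  have h2 := norm_sub_norm_le t s
  rw [norm_inv]
  exact inv_anti₀ (by linarith) (by linarith)

theorem circleIntegrable_cauchy {F : ℂ → ℂ} (hF : ContinuousOn F (sphere 0 1)) (hs : ‖s‖ < 1) :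
    CircleIntegrable (fun t => (t - s)⁻¹ • F t) 0 1 := by
  have h1 : ContinuousOn (fun t : ℂ => (t - s)⁻¹) (sphere 0 1) :=
    (continuousOn_id.sub continuousOn_const).inv₀ (fun t ht => sub_ne_zero_of_mem_sphere ht hs)
  exact (h1.smul hF).circleIntegrable zero_le_one

theorem continuousAt_cauchyTransform (hO : IsOpen O) (hq : ContinuousOn q (O ×ˢ sphere 0 1))
    (hz : z₀ ∈ O) (hs : ‖s‖ < 1) : ContinuousAt (fun z => cauchyTransform q z s) z₀ := by
  rw [Metric.continuousAt_iff]
  intro η hη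
  have hs' : 0 < 1 - ‖s‖ := by linarith
  obtain ⟨δ, hδ, hsub, h⟩ := exists_forall_norm_sub_lt hO (isCompact_sphere 0 1) hq hz
    (η := η / 2 * (1 - ‖s‖)) (by positivity)
  refine ⟨δ, hδ, fun {z} hzb => ?_⟩
  have hzO : z ∈ O := hsub hzb
  have hslice : ∀ w ∈ O, ContinuousOn (fun t => q (w, t)) (sphere 0 1) := fun w hw =>
    hq.comp (by fun_prop) (fun t ht => ⟨hw, ht⟩)
  rw [dist_eq_norm, cauchyTransform, cauchyTransform, ← smul_sub, ← circleIntegral.integral_sub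
    (circleIntegrable_cauchy (hslice z hzO) hs) (circleIntegrable_cauchy (hslice z₀ hz) hs)]
  refine lt_of_le_of_lt (circleIntegral.norm_two_pi_i_inv_smul_integral_le_of_norm_le_const
    zero_le_one (C := η / 2) fun t ht => ?_) (by linarith)
  rw [← smul_sub, norm_smul]
  calc ‖(t - s)⁻¹‖ * ‖q (z, t) - q (z₀, t)‖ ≤ (1 - ‖s‖)⁻¹ * (η / 2 * (1 - ‖s‖)) := by
        gcongr
        · exact norm_inv_sub_le_of_mem_sphere ht hs
        · exact (h z hzb t ht).le
    _ = η / 2 := by field_simp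

/-- Cauchy's estimate for the difference of two slices, which are uniformly close on a closed disk
around `z₀` by compactness. -/
theorem continuousOn_deriv_fst {K : Set ℂ} (hO : IsOpen O)
    (hq : ContinuousOn q (O ×ˢ K)) (hd : ∀ t ∈ K, DifferentiableOn ℂ (fun z => q (z, t)) O)
    (hz : z₀ ∈ O) : ContinuousOn (fun t => deriv (fun z => q (z, t)) z₀) K := by
  obtain ⟨r, hr, hrO⟩ := Metric.nhds_basis_closedBall.mem_iff.1 (hO.mem_nhds hz)
  intro t₀ ht₀
  rw [Metric.continuousWithinAt_iff]
  intro η hη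
  have hq' : ContinuousOn (fun p : ℂ × ℂ => q (p.2, p.1)) (K ×ˢ closedBall z₀ r) :=
    hq.comp (by fun_prop) (fun p hp => ⟨hrO hp.2, hp.1⟩)
  obtain ⟨v, hv, h⟩ := (isCompact_closedBall z₀ r).mem_uniformity_of_prod
    (f := fun t z => q (z, t)) hq' ht₀ (dist_mem_uniformity (ε := η / 2 * r) (by positivity))
  obtain ⟨δ, hδ, hb⟩ := Metric.mem_nhdsWithin_iff.1 hv
  refine ⟨δ, hδ, fun {t} ht htd => ?_⟩
  have hdat : ∀ t ∈ K, DifferentiableAt ℂ (fun z => q (z, t)) z₀ := fun t ht =>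
    (hd t ht).differentiableAt (hO.mem_nhds hz)
  rw [dist_eq_norm, ← deriv_fun_sub (hdat t ht) (hdat t₀ ht₀)]
  have hdc : DiffContOnCl ℂ (fun z => q (z, t) - q (z, t₀)) (ball z₀ r) := by
    refine DifferentiableOn.diffContOnCl ?_
    rw [closure_ball _ hr.ne']
    exact ((hd t ht).sub (hd t₀ ht₀)).mono hrO
  have := norm_deriv_le_of_forall_mem_sphere_norm_le hr hdc (C := η / 2 * r) (fun z hz' => by
    have := h t (hb ⟨htd, ht⟩) z (sphere_subset_closedBall hz')
    rw [mem_ofPred_eq, dist_eq_norm] at this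
    exact this.le)
  rw [mul_div_cancel_right₀ _ hr.ne'] at this
  linarith

theorem differentiableOn_cauchyTransform (hO : IsOpen O)
    (hq : ContinuousOn q (O ×ˢ sphere 0 1))
    (hd : ∀ t ∈ sphere (0 : ℂ) 1, DifferentiableOn ℂ (fun z => q (z, t)) O) (hs : ‖s‖ < 1) :
    DifferentiableOn ℂ (fun z => cauchyTransform q z s) O := by
  intro z₀ hz
  refine DifferentiableAt.differentiableWithinAt ?_
  unfold cauchyTransform
  suffices h : DifferentiableAt ℂ (fun z => ∮ t in C(0, 1), (t - s)⁻¹ • q (z, t)) z₀ from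
    h.fun_const_smul _
  obtain ⟨r, hr, hrO⟩ := Metric.nhds_basis_closedBall.mem_iff.1 (hO.mem_nhds hz)
  obtain ⟨M, hM⟩ := ((isCompact_closedBall z₀ r).prod (isCompact_sphere (0 : ℂ) 1)).exists_bound_of_continuousOn
    (hq.mono (prod_mono_left hrO))
  have hmem : ∀ θ : ℝ, circleMap 0 1 θ ∈ sphere (0 : ℂ) 1 := fun θ => by simp [circleMap]
  have hslice : ∀ w ∈ O, Continuous fun θ : ℝ =>
      deriv (circleMap 0 1) θ • (circleMap 0 1 θ - s)⁻¹ • q (w, circleMap 0 1 θ) := by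
    intro w hw
    have h1 : Continuous fun θ : ℝ => q (w, circleMap 0 1 θ) :=
      hq.comp_continuous (by fun_prop) (fun θ => ⟨hw, hmem θ⟩)
    have h2 : Continuous fun θ : ℝ => (circleMap 0 1 θ - s)⁻¹ :=
      ((continuous_circleMap 0 1).sub continuous_const).inv₀
        (fun θ => sub_ne_zero_of_mem_sphere (hmem θ) hs)
    simp only [deriv_circleMap]
    exact (((continuous_circleMap 0 1).mul continuous_const)).smul (h2.smul h1)
  have hderiv : Continuous fun θ : ℝ => deriv (circleMap 0 1) θ • (circleMap 0 1 θ - s)⁻¹ •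
      deriv (fun z => q (z, circleMap 0 1 θ)) z₀ := by
    have h1 : Continuous fun θ : ℝ => deriv (fun z => q (z, circleMap 0 1 θ)) z₀ :=
      (continuousOn_deriv_fst hO hq hd hz).comp_continuous
        (continuous_circleMap 0 1) hmem
    have h2 : Continuous fun θ : ℝ => (circleMap 0 1 θ - s)⁻¹ :=
      ((continuous_circleMap 0 1).sub continuous_const).inv₀
        (fun θ => sub_ne_zero_of_mem_sphere (hmem θ) hs)
    simp only [deriv_circleMap]
    exact (((continuous_circleMap 0 1).mul continuous_const)).smul (h2.smul h1)
  have key := intervalIntegral.hasDerivAt_integral_of_dominated_loc_of_deriv_le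
    (μ := MeasureTheory.volume) (a := 0) (b := 2 * Real.pi) (x₀ := z₀) (s := ball z₀ (r / 2))
    (F := fun z θ => deriv (circleMap 0 1) θ • (circleMap 0 1 θ - s)⁻¹ • q (z, circleMap 0 1 θ))
    (F' := fun z θ => deriv (circleMap 0 1) θ • (circleMap 0 1 θ - s)⁻¹ •
      deriv (fun z => q (z, circleMap 0 1 θ)) z)
    -- Kernel bound times Cauchy's estimate on circles of radius r/2, which stay in the closed disk
    -- where |q| ≤ M.
    (bound := fun _ => (1 - ‖s‖)⁻¹ * (M / (r / 2)))
    (ball_mem_nhds _ (by positivity))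
    (by
      filter_upwards [hO.mem_nhds hz] with w hw
      exact (hslice w hw).aestronglyMeasurable)
    ((hslice z₀ hz).intervalIntegrable _ _)
    hderiv.aestronglyMeasurable
    (Eventually.of_forall fun θ _ w hw => by
      have hdc : DiffContOnCl ℂ (fun z => q (z, circleMap 0 1 θ)) (ball w (r / 2)) := by
        refine DifferentiableOn.diffContOnCl ?_
        rw [closure_ball _ (by positivity)]
        refine (hd _ (hmem θ)).mono (Subset.trans (fun y hy => ?_) hrO)
        rw [mem_ball] at hw
        rw [mem_closedBall] at hy ⊢
        linarith [dist_triangle y w z₀]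
      have h1 := norm_deriv_le_of_forall_mem_sphere_norm_le (by positivity) hdc (C := M)
        (fun y hy => hM (y, circleMap 0 1 θ) ⟨by
          rw [mem_ball] at hw
          rw [mem_sphere] at hy
          rw [mem_closedBall]
          linarith [dist_triangle y w z₀], hmem θ⟩)
      rw [norm_smul, norm_smul]
      have h2 : ‖deriv (circleMap 0 1) θ‖ = 1 := by simp [circleMap]
      rw [h2, one_mul]
      exact mul_le_mul (norm_inv_sub_le_of_mem_sphere (hmem θ) hs) h1 (norm_nonneg _)
        (inv_nonneg.2 (by linarith)))
    (by simp)
    (Eventually.of_forall fun θ _ w hw => by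
      have hwO : w ∈ O := hrO (by
        rw [mem_ball] at hw
        rw [mem_closedBall]
        linarith)
      exact ((((hd _ (hmem θ)).differentiableAt (hO.mem_nhds hwO)).hasDerivAt).const_smul
        ((circleMap 0 1 θ - s)⁻¹)).const_smul (deriv (circleMap 0 1) θ))
  exact key.2.differentiableAt

theorem ExtendsAt.cauchyTransform_eq (h : ExtendsAt q ρ z) (h1 : ρ < ‖s‖)
    (h2 : ‖s‖ < 1) : cauchyTransform q z s = q (z, s) := by
  obtain ⟨G, hG, he⟩ := h
  have hsb : s ∈ ball (0 : ℂ) 1 := by simpa using h2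
  rw [← he s h1 h2.le, cauchyTransform, circleIntegral.integral_congr zero_le_one
    (g := fun t => (t - s)⁻¹ • G t)]
  · exact hG.two_pi_i_inv_smul_circleIntegral_sub_inv_smul hsb
  · intro t ht
    have : ‖t‖ = 1 := by simpa using ht
    simp only [he t (by linarith) this.le]

/-- With its converse `ExtendsAt.cauchyTransform_eq` this turns extendability into an equation
between functions of `z`, which can be continued in `z`. -/
theorem extendsAt_of_cauchyTransform_eq (hρ : ρ < 1) (hA : IsOpen A)
    (hρA : ∀ s, ρ ≤ ‖s‖ → ‖s‖ ≤ 1 → s ∈ A) (hq : DifferentiableOn ℂ (fun s => q (z, s)) A)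
    (h : ∀ s, ρ < ‖s‖ → ‖s‖ < 1 → cauchyTransform q z s = q (z, s)) : ExtendsAt q ρ z := by
  classical
  have hsph := sphere_subset_of_annulus hρ hρA
  let G : ℂ → ℂ := fun s => if ‖s‖ < 1 then cauchyTransform q z s else q (z, s)
  have hci : CircleIntegrable (fun t => q (z, t)) 0 1 :=
    (hq.continuousOn.mono hsph).circleIntegrable zero_le_one
  have hps := hasFPowerSeriesOn_cauchy_integral (R := 1) hci one_pos
  have hdiff : DifferentiableOn ℂ G (ball 0 1) := by
    have h1 : DifferentiableOn ℂ (fun s => cauchyTransform q z s) (ball 0 1) := by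
      have := hps.differentiableOn
      rwa [Metric.eball_coe, NNReal.coe_one] at this
    exact h1.congr fun s hs => by
      have : ‖s‖ < 1 := by simpa using hs
      simp [G, this]
  have heq : ∀ s, ρ < ‖s‖ → G s = q (z, s) := by
    intro s hs
    by_cases h1 : ‖s‖ < 1
    · simp [G, h1, h s hs h1]
    · simp [G, h1]
  refine ⟨G, ⟨hdiff, ?_⟩, fun s hs _ => heq s hs⟩
  rw [closure_ball _ one_ne_zero]
  intro s hs
  by_cases h1 : ‖s‖ < 1
  · exact (hdiff.differentiableAt (isOpen_ball.mem_nhds (by simpa using h1))).continuousAt.continuousWithinAt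
  · have h2 : ‖s‖ = 1 := le_antisymm (by simpa using hs) (not_lt.1 h1)
    have hc : ContinuousAt (fun s => q (z, s)) s :=
      (hq.differentiableAt (hA.mem_nhds (hρA s (by linarith) h2.le))).continuousAt
    refine ContinuousAt.continuousWithinAt (hc.congr ?_)
    filter_upwards [(isOpen_lt continuous_const continuous_norm).mem_nhds
      (show ρ < ‖s‖ by linarith)] with y hy
    exact (heq y hy).symm

/-- Both sides of the Cauchy identity are continuous in `z`. Only continuity is asked in that
variable, since the root `g` need not be holomorphic in `z` over the lower half plane. -/
theorem extendsAt_of_mem_closure (hρ : ρ < 1) (hA : IsOpen A)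
    (hρA : ∀ s, ρ ≤ ‖s‖ → ‖s‖ ≤ 1 → s ∈ A) (hO : IsOpen O) (hq : ContinuousOn q (O ×ˢ A))
    (hz : z₀ ∈ O) (hd : DifferentiableOn ℂ (fun s => q (z₀, s)) A)
    (hcl : z₀ ∈ closure {z | ExtendsAt q ρ z}) : ExtendsAt q ρ z₀ := by
  refine extendsAt_of_cauchyTransform_eq hρ hA hρA hd fun s h1 h2 => ?_
  by_contra hne
  have hsA : s ∈ A := hρA s h1.le h2.le
  have hc1 : ContinuousAt (fun z => cauchyTransform q z s) z₀ :=
    continuousAt_cauchyTransform hO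
      (hq.mono (prod_mono_right (sphere_subset_of_annulus hρ hρA))) hz h2
  have hc2 : ContinuousAt (fun z => q (z, s)) z₀ :=
    (hq.continuousAt ((hO.prod hA).mem_nhds ⟨hz, hsA⟩)).comp (f := fun z => (z, s))
      (by fun_prop)
  obtain ⟨z, hz1, hz2⟩ := (mem_closure_iff_frequently.1 hcl).and_eventually
    (hc1.ne_iff_eventually_ne hc2 |>.1 hne) |>.exists
  exact hz2 (hz1.cauchyTransform_eq h1 h2)

/-- Hartogs continuation: both sides of the Cauchy identity are holomorphic in `z`, so the identity
theorem applies. -/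
theorem extendsAt_of_preconnected (hρ : ρ < 1) (hA : IsOpen A)
    (hρA : ∀ s, ρ ≤ ‖s‖ → ‖s‖ ≤ 1 → s ∈ A) (hO : IsOpen O) (hOc : IsPreconnected O)
    (hq : DifferentiableOn ℂ q (O ×ˢ A)) (hz₀ : z₀ ∈ O)
    (hev : ∀ᶠ z in 𝓝 z₀, ExtendsAt q ρ z) : ∀ z ∈ O, ExtendsAt q ρ z := by
  have hfst : ∀ t ∈ A, DifferentiableOn ℂ (fun z => q (z, t)) O := fun t ht =>
    hq.comp (by fun_prop) (fun z hz => ⟨hz, ht⟩)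
  have hsph := sphere_subset_of_annulus hρ hρA
  intro z hz
  refine extendsAt_of_cauchyTransform_eq hρ hA hρA
    (hq.comp (by fun_prop) (fun t ht => ⟨hz, ht⟩)) fun s h1 h2 => ?_
  have hs1 : DifferentiableOn ℂ (fun z => cauchyTransform q z s) O :=
    differentiableOn_cauchyTransform hO (hq.continuousOn.mono (prod_mono_right hsph))
      (fun t ht => hfst t (hsph ht)) h2
  exact (hs1.analyticOnNhd hO).eqOn_of_preconnected_of_eventuallyEq
    ((hfst s (hρA s h1.le h2.le)).analyticOnNhd hO) hOc hz₀
    (hev.mono fun z hz => hz.cauchyTransform_eq h1 h2) hz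

end CauchyTransform

/-! ### Local analysis of the root near one slice: with and without zeros. -/

section ContinuationOfRoots

open Complex Filter Topology

theorem norm_le_of_forall_mem_sphere {F : ℂ → ℂ} (hF : DiffContOnCl ℂ F (ball 0 1)) {C : ℝ}
    (hC : ∀ s ∈ sphere (0 : ℂ) 1, ‖F s‖ ≤ C) : ∀ s ∈ closedBall (0 : ℂ) 1, ‖F s‖ ≤ C := by
  intro s hs
  refine norm_le_of_forall_mem_frontier_norm_le isBounded_ball hF (fun t ht => hC t ?_) ?_
  · rwa [frontier_ball _ one_ne_zero] at ht
  · rwa [closure_ball _ one_ne_zero]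

/-- The maximum principle for 1/F. -/
theorem le_norm_of_forall_mem_sphere {F : ℂ → ℂ} (hF : DiffContOnCl ℂ F (ball 0 1)) {C : ℝ}
    (hC0 : 0 < C) (hC : ∀ s ∈ sphere (0 : ℂ) 1, C ≤ ‖F s‖)
    (h0 : ∀ s ∈ closedBall (0 : ℂ) 1, F s ≠ 0) : ∀ s ∈ closedBall (0 : ℂ) 1, C ≤ ‖F s‖ := by
  intro s hs
  have h1 := norm_le_of_forall_mem_sphere (hF.inv (fun t ht => h0 t (by
    rwa [closure_ball _ one_ne_zero] at ht))) (C := C⁻¹) (fun t ht => by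
      rw [Pi.inv_apply, norm_inv]
      exact inv_anti₀ hC0 (hC t ht)) s hs
  rw [Pi.inv_apply, norm_inv] at h1
  exact (inv_le_inv₀ (norm_pos_iff.2 (h0 s hs)) hC0).1 h1

/-- A continuous square root of a nowhere vanishing holomorphic function is holomorphic. -/
theorem differentiableOn_of_sq {A : Set ℂ} (hA : IsOpen A) {k : ℂ → ℂ} (hk : ContinuousOn k A)
    (h0 : ∀ s ∈ A, k s ≠ 0) (hd : DifferentiableOn ℂ (fun s => k s ^ 2) A) :
    DifferentiableOn ℂ k A := by
  intro s₀ hs₀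
  have hn := hA.mem_nhds hs₀
  have hkc : ContinuousAt k s₀ := hk.continuousAt hn
  have hsum : Tendsto (fun s => k s + k s₀) (𝓝 s₀) (𝓝 (2 * k s₀)) := by
    rw [two_mul]; exact hkc.tendsto.add_const _
  have h2 : 2 * k s₀ ≠ 0 := mul_ne_zero two_ne_zero (h0 s₀ hs₀)
  have hd₀ := (hd.differentiableAt hn).hasDerivAt
  rw [hasDerivAt_iff_tendsto_slope] at hd₀
  -- The difference quotient of `k` is that of k² divided by k(s) + k(s₀).
  have key : HasDerivAt k (deriv (fun s => k s ^ 2) s₀ / (2 * k s₀)) s₀ := by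
    rw [hasDerivAt_iff_tendsto_slope]
    refine (hd₀.div (hsum.mono_left nhdsWithin_le_nhds) h2).congr' ?_
    filter_upwards [nhdsWithin_le_nhds (hsum.eventually_ne h2)] with s hs
    simp only [Pi.div_apply, slope_def_field]
    by_cases hss : s - s₀ = 0
    · simp [hss]
    · field_simp
      ring
  exact key.differentiableAt.differentiableWithinAt

/-- Cauchy's estimate bounds the `z`-derivative uniformly for `s` on the compact circle. -/
theorem exists_lipschitz_fst {q : ℂ × ℂ → ℂ} {O : Set ℂ} (hO : IsOpen O)
    (hq : ContinuousOn q (O ×ˢ sphere 0 1))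
    (hd : ∀ t ∈ sphere (0 : ℂ) 1, DifferentiableOn ℂ (fun z => q (z, t)) O) {z₀ : ℂ} (hz : z₀ ∈ O) :
    ∃ r > 0, ∃ L ≥ 0, ∀ z ∈ ball z₀ r, ∀ z' ∈ ball z₀ r, ∀ s ∈ sphere (0 : ℂ) 1,
      ‖q (z, s) - q (z', s)‖ ≤ L * ‖z - z'‖ := by
  obtain ⟨r, hr, hrO⟩ := Metric.nhds_basis_closedBall.mem_iff.1 (hO.mem_nhds hz)
  obtain ⟨M, hM⟩ := ((isCompact_closedBall z₀ r).prod
    (isCompact_sphere (0 : ℂ) 1)).exists_bound_of_continuousOn (hq.mono (prod_mono_left hrO))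
  have hM0 : 0 ≤ M := (norm_nonneg _).trans (hM (z₀, 1) ⟨mem_closedBall_self hr.le, by simp⟩)
  refine ⟨r / 2, by positivity, M / (r / 2), by positivity, fun z hz z' hz' s hs => ?_⟩
  refine (convex_ball z₀ (r / 2)).norm_image_sub_le_of_norm_deriv_le (𝕜 := ℂ)
    (f := fun z => q (z, s)) (fun w hw => ?_) (fun w hw => ?_) hz' hz
  · refine (hd s hs).differentiableAt (hO.mem_nhds (hrO ?_))
    rw [mem_ball] at hw
    rw [mem_closedBall]
    linarith
  · have hdc : DiffContOnCl ℂ (fun z => q (z, s)) (ball w (r / 2)) := by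
      refine DifferentiableOn.diffContOnCl ?_
      rw [closure_ball _ (by positivity)]
      refine (hd _ hs).mono (Subset.trans (fun y hy => ?_) hrO)
      rw [mem_ball] at hw
      rw [mem_closedBall] at hy ⊢
      linarith [dist_triangle y w z₀]
    exact norm_deriv_le_of_forall_mem_sphere_norm_le (by positivity) hdc
      (fun y hy => hM (y, s) ⟨by
        rw [mem_ball] at hw
        rw [mem_sphere] at hy
        rw [mem_closedBall]
        linarith [dist_triangle y w z₀], hs⟩)

/-- The data obtained from a foliated holomorphic map of a Hartogs figure to the surface: `h` is
holomorphic, and `g` is a continuous fibrewise holomorphic square root of `h + wildFun ∘ ζ`, which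
is holomorphic over the upper half plane and does not vanish over the lower half plane. -/
structure IsFoliatedRoot (ρ R : ℝ) (A : Set ℂ) (ζ : ℂ → ℂ) (h g : ℂ × ℂ → ℂ) : Prop where
  rho_lt : ρ < 1
  isOpen_A : IsOpen A
  mem_A : ∀ s, ρ ≤ ‖s‖ → ‖s‖ ≤ 1 → s ∈ A
  diff_ζ : DifferentiableOn ℂ ζ (ball 0 R)
  diff_h : DifferentiableOn ℂ h (ball 0 R ×ˢ A)
  cont_g : ContinuousOn g (ball 0 R ×ˢ A)
  sq : ∀ z ∈ ball 0 R, ∀ s ∈ A, g (z, s) ^ 2 = h (z, s) + wildFun (ζ z)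
  ne_zero : ∀ z ∈ ball 0 R, (ζ z).im ≤ 0 → ∀ s ∈ A, g (z, s) ≠ 0
  diff_g : DifferentiableOn ℂ g ({z | z ∈ ball 0 R ∧ 0 < (ζ z).im} ×ˢ A)

namespace IsFoliatedRoot

variable {ρ R : ℝ} {A : Set ℂ} {ζ : ℂ → ℂ} {h g : ℂ × ℂ → ℂ}

theorem sphere_subset (H : IsFoliatedRoot ρ R A ζ h g) : sphere (0 : ℂ) 1 ⊆ A :=
  sphere_subset_of_annulus H.rho_lt H.mem_A

/-- On one slice the `wildFun` term is a constant, so over the lower half plane `g` is a zero-free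
root of a holomorphic function of `s`. -/
theorem diff_slice (H : IsFoliatedRoot ρ R A ζ h g) {z : ℂ} (hz : z ∈ ball 0 R) :
    DifferentiableOn ℂ (fun s => g (z, s)) A := by
  by_cases hi : 0 < (ζ z).im
  · exact H.diff_g.comp (by fun_prop) (fun s hs => ⟨⟨hz, hi⟩, hs⟩)
  · refine differentiableOn_of_sq H.isOpen_A (H.cont_g.comp (by fun_prop) (fun s hs => ⟨hz, hs⟩))
      (H.ne_zero z hz (not_lt.1 hi)) ?_
    have h1 : DifferentiableOn ℂ (fun s => h (z, s)) A :=
      H.diff_h.comp (by fun_prop) (fun s hs => ⟨hz, hs⟩)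
    exact (h1.add_const (wildFun (ζ z))).congr (fun s hs => H.sq z hz s hs)

theorem continuousAt_wildFun (H : IsFoliatedRoot ρ R A ζ h g) {z : ℂ} (hz : z ∈ ball 0 R) :
    ContinuousAt (fun z => wildFun (ζ z)) z :=
  continuous_wildFun.continuousAt.comp
    (H.diff_ζ.differentiableAt (isOpen_ball.mem_nhds hz)).continuousAt

theorem cont_sq (H : IsFoliatedRoot ρ R A ζ h g) :
    ContinuousOn (fun p => g p ^ 2) (ball 0 R ×ˢ A) := H.cont_g.pow 2

/-- If the slice at `z₀` extends without zeros, so do the slices near `z₀`. -/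
theorem eventually_extendsAt (H : IsFoliatedRoot ρ R A ζ h g)
    (hh : ∀ z ∈ ball 0 R, ExtendsAt h ρ z) {z₀ : ℂ} (hz₀ : z₀ ∈ ball 0 R) {G₀ : ℂ → ℂ}
    (hG₀ : DiffContOnCl ℂ G₀ (ball 0 1)) (he : ∀ s, ρ < ‖s‖ → ‖s‖ ≤ 1 → G₀ s = g (z₀, s))
    (h0 : ∀ s ∈ closedBall (0 : ℂ) 1, G₀ s ≠ 0) : ∀ᶠ z in 𝓝 z₀, ExtendsAt g ρ z := by
  have hcl : closure (ball (0 : ℂ) 1) = closedBall 0 1 := closure_ball _ one_ne_zero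
  have hG₀c : ContinuousOn G₀ (closedBall 0 1) := hcl ▸ hG₀.continuousOn
  obtain ⟨s₁, hs₁, hmin⟩ := (isCompact_closedBall (0 : ℂ) 1).exists_isMinOn
    ⟨0, by simp⟩ hG₀c.norm
  set m := ‖G₀ s₁‖ with hm
  have hm0 : 0 < m := norm_pos_iff.2 (h0 s₁ hs₁)
  have hmle : ∀ s ∈ closedBall (0 : ℂ) 1, m ≤ ‖G₀ s‖ := fun s hs => hmin hs
  set K : Set ℂ := closedBall 0 1 \ ball 0 ρ with hKdef
  have hK : IsCompact K := (isCompact_closedBall 0 1).diff isOpen_ball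
  have hKA : K ⊆ A := fun s hs => H.mem_A s (by simpa [hKdef] using hs.2) (by simpa using hs.1)
  obtain ⟨δ₁, hδ₁, hs1, hb1⟩ := exists_forall_norm_sub_lt isOpen_ball hK
    (H.cont_g.mono (prod_mono_right hKA)) hz₀ hm0
  obtain ⟨δ₂, hδ₂, hs2, hb2⟩ := exists_forall_norm_sub_lt isOpen_ball (isCompact_sphere 0 1)
    (H.cont_sq.mono (prod_mono_right H.sphere_subset)) hz₀ (η := m ^ 2 / 2) (by positivity)
  obtain ⟨E₀, hE₀, hEe₀⟩ := hh z₀ hz₀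
  filter_upwards [ball_mem_nhds z₀ hδ₁, ball_mem_nhds z₀ hδ₂] with z hz1 hz2
  have hzB : z ∈ ball 0 R := hs1 hz1
  obtain ⟨E, hE, hEe⟩ := hh z hzB
  -- The holomorphic extension to the disk of the difference of the squares of the two slices.
  set N : ℂ → ℂ := fun s => (E s - E₀ s) + (wildFun (ζ z) - wildFun (ζ z₀)) with hN
  have hNd : DiffContOnCl ℂ N (ball 0 1) := (hE.sub hE₀).add_const _
  have hNe : ∀ s, ρ < ‖s‖ → ‖s‖ ≤ 1 → N s = g (z, s) ^ 2 - g (z₀, s) ^ 2 := by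
    intro s h1 h2
    have hsA := H.mem_A s h1.le h2
    rw [H.sq z hzB s hsA, H.sq z₀ hz₀ s hsA, hN]
    simp only [hEe s h1 h2, hEe₀ s h1 h2]
    ring
  have hNle : ∀ s ∈ closedBall (0 : ℂ) 1, ‖N s‖ ≤ m ^ 2 / 2 := by
    refine norm_le_of_forall_mem_sphere hNd fun s hs => ?_
    have hs' : ‖s‖ = 1 := by simpa using hs
    rw [hNe s (by linarith [H.rho_lt]) hs'.le]
    exact (hb2 z hz2 s hs).le
  -- G₀² + N = G₀² (1 + Q) with |Q| < 1, so the principal root of 1 + Q corrects `G₀` to the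
  -- extension sought.
  set Q : ℂ → ℂ := fun s => N s * (G₀ s ^ 2)⁻¹ with hQ
  have hQle : ∀ s ∈ closedBall (0 : ℂ) 1, ‖Q s‖ < 1 := by
    intro s hs
    have h1 : m ^ 2 ≤ ‖G₀ s‖ ^ 2 := by
      have := hmle s hs
      gcongr
    rw [hQ, norm_mul, norm_inv, norm_pow, ← div_eq_mul_inv, div_lt_one (pow_pos (hm0.trans_le (hmle s hs)) 2)]
    have := hNle s hs
    have : 0 < m ^ 2 := by positivity
    linarith
  have hsp : ∀ s ∈ closedBall (0 : ℂ) 1, 1 + Q s ∈ slitPlane := fun s hs =>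
    mem_slitPlane_of_norm_lt_one (hQle s hs)
  have hQd : DifferentiableOn ℂ Q (ball 0 1) :=
    hNd.differentiableOn.mul ((hG₀.differentiableOn.pow 2).inv
      (fun s hs => pow_ne_zero 2 (h0 s (ball_subset_closedBall hs))))
  have hQc : ContinuousOn Q (closedBall 0 1) :=
    (hcl ▸ hNd.continuousOn).mul ((hG₀c.pow 2).inv₀ (fun s hs => pow_ne_zero 2 (h0 s hs)))
  set e : ℂ → ℂ := fun s => exp (log (1 + Q s) / 2) with he'
  have hed : DifferentiableOn ℂ e (ball 0 1) :=
    (((hQd.const_add 1).clog (fun s hs => hsp s (ball_subset_closedBall hs))).div_const 2).cexp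
  have hec : ContinuousOn e (closedBall 0 1) :=
    (((continuousOn_const.add hQc).clog hsp).div_const 2).cexp
  have hesq : ∀ s ∈ closedBall (0 : ℂ) 1, e s ^ 2 = 1 + Q s := by
    intro s hs
    rw [he', ← exp_nat_mul]
    simp only [Nat.cast_ofNat]
    rw [mul_div_cancel₀ _ two_ne_zero, exp_log (slitPlane_ne_zero (hsp s hs))]
  have here : ∀ s, 0 ≤ (e s).re := by
    intro s
    rw [he']
    simp only [exp_re]
    refine mul_nonneg (Real.exp_pos _).le (Real.cos_nonneg_of_neg_pi_div_two_le_of_le ?_ ?_)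
    · have := neg_pi_lt_arg (1 + Q s)
      simp only [Complex.div_ofNat_im, log_im]
      linarith
    · have := arg_le_pi (1 + Q s)
      simp only [Complex.div_ofNat_im, log_im]
      linarith
  refine ⟨fun s => G₀ s * e s, ⟨hG₀.differentiableOn.mul hed, ?_⟩, fun s h1 h2 => ?_⟩
  · rw [hcl]
    exact hG₀c.mul hec
  have hsb : s ∈ closedBall (0 : ℂ) 1 := by simpa using h2
  have hsq : (G₀ s * e s) ^ 2 = g (z, s) ^ 2 := by
    rw [mul_pow, hesq s hsb, hQ]
    simp only
    rw [hNe s h1 h2, mul_add, mul_one, mul_comm (_ - _), mul_inv_cancel_left₀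
      (pow_ne_zero 2 (h0 s hsb)), he s h1 h2]
    ring
  rcases sq_eq_sq_iff_eq_or_eq_neg.1 hsq with hpos | hneg
  · exact hpos
  -- The wrong sign would put g(z, s) at distance |G₀| |1 + e| ≥ m from g(z₀, s), because Re e ≥ 0;
  -- this excludes it for `z` near `z₀`.
  · exfalso
    have h3 := hb1 z hz1 s ⟨hsb, by simpa using h1.le⟩
    have h4 : g (z, s) - g (z₀, s) = -(G₀ s * (1 + e s)) := by
      rw [← he s h1 h2]
      linear_combination hneg
    rw [h4, norm_neg, norm_mul] at h3
    have h5 : 1 ≤ ‖1 + e s‖ := by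
      have := re_le_norm (1 + e s)
      simp only [add_re, one_re] at this
      linarith [here s]
    have h6 := hmle s hsb
    nlinarith [norm_nonneg (G₀ s)]

/-- If the slice at `z₀` extends with a zero, then `wildFun ∘ ζ` is Lipschitz on the set of points
near `z₀` at which the slice extends. -/
theorem exists_lipschitz (H : IsFoliatedRoot ρ R A ζ h g) {z₀ : ℂ} (hz₀ : z₀ ∈ ball 0 R)
    (hi : (ζ z₀).im ≤ 0) {G₀ : ℂ → ℂ} (hG₀ : DiffContOnCl ℂ G₀ (ball 0 1))
    (he : ∀ s, ρ < ‖s‖ → ‖s‖ ≤ 1 → G₀ s = g (z₀, s)) {s₀ : ℂ} (hs₀ : s₀ ∈ closedBall (0 : ℂ) 1)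
    (h0 : G₀ s₀ = 0) :
    ∃ r > 0, ∃ L : ℝ, ∀ z ∈ ball z₀ r, ∀ z' ∈ ball z₀ r, ExtendsAt g ρ z → ExtendsAt g ρ z' →
      ‖wildFun (ζ z) - wildFun (ζ z')‖ ≤ L * ‖z - z'‖ := by
  have hgs : ContinuousOn (fun s => g (z₀, s)) (sphere 0 1) :=
    H.cont_g.comp (by fun_prop) (fun s hs => ⟨hz₀, H.sphere_subset hs⟩)
  obtain ⟨s₁, hs₁, hmin⟩ := (isCompact_sphere (0 : ℂ) 1).exists_isMinOn ⟨1, by simp⟩ hgs.norm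
  set m := ‖g (z₀, s₁)‖ with hm
  have hm0 : 0 < m := norm_pos_iff.2 (H.ne_zero z₀ hz₀ hi s₁ (H.sphere_subset hs₁))
  have hmle : ∀ s ∈ sphere (0 : ℂ) 1, m ≤ ‖g (z₀, s)‖ := fun s hs => hmin hs
  obtain ⟨δ₁, hδ₁, hsub, hb1⟩ := exists_forall_norm_sub_lt isOpen_ball (isCompact_sphere 0 1)
    (H.cont_g.mono (prod_mono_right H.sphere_subset)) hz₀ (η := m / 4) (by positivity)
  obtain ⟨δ₂, hδ₂, L, hL, hb2⟩ := exists_lipschitz_fst isOpen_ball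
    (H.diff_h.continuousOn.mono (prod_mono_right H.sphere_subset))
    (fun t ht => H.diff_h.comp (by fun_prop) (fun z hz => ⟨hz, H.sphere_subset ht⟩)) hz₀
  obtain ⟨δ₃, hδ₃, hb3⟩ := Metric.continuousAt_iff.1 (H.continuousAt_wildFun hz₀)
    (m ^ 2 / 12) (by positivity)
  -- Together with `δ₃`, this makes both `t` and `X` below at most m²/6.
  set δ₄ := m ^ 2 / (12 * (L + 1)) with hδ₄
  have hδ₄0 : 0 < δ₄ := by positivity
  refine ⟨min (min δ₁ δ₂) (min δ₃ δ₄), by positivity, 2 * L, fun z hz z' hz' hez hez' => ?_⟩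
  simp only [mem_ball, lt_min_iff] at hz hz'
  obtain ⟨⟨hz1, hz2⟩, hz3, hz4⟩ := hz
  obtain ⟨⟨hz'1, hz'2⟩, hz'3, hz'4⟩ := hz'
  have hzB : z ∈ ball 0 R := hsub hz1
  have hz'B : z' ∈ ball 0 R := hsub hz'1
  obtain ⟨G, hG, hGe⟩ := hez
  obtain ⟨G', hG', hGe'⟩ := hez'
  set t := L * ‖z - z'‖ with ht
  set X := ‖wildFun (ζ z) - wildFun (ζ z')‖ with hX
  have ht0 : 0 ≤ t := by positivity
  have hX0 : 0 ≤ X := norm_nonneg _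
  have hts : t ≤ m ^ 2 / 6 := by
    have h1 : ‖z - z'‖ ≤ 2 * δ₄ := by
      rw [← dist_eq_norm]
      linarith [dist_triangle_right z z' z₀]
    calc t ≤ L * (2 * δ₄) := by rw [ht]; gcongr
      _ ≤ (L + 1) * (2 * δ₄) := by gcongr; linarith
      _ = m ^ 2 / 6 := by rw [hδ₄]; field_simp; norm_num
  have hXs : X ≤ m ^ 2 / 6 := by
    have h1 := hb3 hz3
    have h2 := hb3 hz'3
    rw [hX, ← dist_eq_norm]
    linarith [dist_triangle_right (wildFun (ζ z)) (wildFun (ζ z')) (wildFun (ζ z₀))]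
  have hsG : ∀ s ∈ sphere (0 : ℂ) 1, G s = g (z, s) ∧ G' s = g (z', s) ∧ G₀ s = g (z₀, s) := by
    intro s hs
    have hs' : ‖s‖ = 1 := by simpa using hs
    have hr : ρ < ‖s‖ := by linarith [H.rho_lt]
    exact ⟨hGe s hr hs'.le, hGe' s hr hs'.le, he s hr hs'.le⟩
  have hlow : ∀ w ∈ ball z₀ δ₁, ∀ s ∈ sphere (0 : ℂ) 1, 3 * m / 4 ≤ ‖g (w, s)‖ := by
    intro w hw s hs
    have h1 := hb1 w hw s hs
    have h2 := hmle s hs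
    have h3 := norm_sub_norm_le (g (z₀, s)) (g (w, s))
    rw [norm_sub_rev] at h3
    linarith
  -- As in Hurwitz's theorem the zero persists: otherwise the minimum principle gives |G'(s₀)| ≥
  -- 3m/4, while |G' − G₀| ≤ m/4 and G₀(s₀) = 0.
  obtain ⟨s₂, hs₂, hz2⟩ : ∃ s ∈ closedBall (0 : ℂ) 1, G' s = 0 := by
    by_contra! hne
    have h1 := le_norm_of_forall_mem_sphere hG' (C := 3 * m / 4) (by positivity)
      (fun s hs => by rw [(hsG s hs).2.1]; exact hlow z' hz'1 s hs) hne s₀ hs₀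
    have h2 := norm_le_of_forall_mem_sphere (hG'.sub hG₀) (C := m / 4) (fun s hs => by
      rw [Pi.sub_apply, (hsG s hs).2.1, (hsG s hs).2.2]
      exact (hb1 z' hz'1 s hs).le) s₀ hs₀
    rw [Pi.sub_apply, h0, sub_zero] at h2
    linarith
  have hsq : ∀ s ∈ sphere (0 : ℂ) 1, g (z, s) ^ 2 - g (z', s) ^ 2 =
      (h (z, s) - h (z', s)) + (wildFun (ζ z) - wildFun (ζ z')) := by
    intro s hs
    rw [H.sq z hzB s (H.sphere_subset hs), H.sq z' hz'B s (H.sphere_subset hs)]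
    ring
  -- On the circle G² − G'² minus the difference of the `wildFun` values is the difference of two
  -- slices of `h`, hence at most `t`; the maximum principle carries this to `s₂`, where G' = 0.
  have hA1 : ‖G s₂ ^ 2 - (wildFun (ζ z) - wildFun (ζ z'))‖ ≤ t := by
    have hd : DiffContOnCl ℂ (fun s => (G s • G s - G' s • G' s) - (wildFun (ζ z) - wildFun (ζ z')))
        (ball 0 1) := ((hG.smul hG).sub (hG'.smul hG')).sub_const _
    have h1 := norm_le_of_forall_mem_sphere hd (C := t) (fun s hs => by
      simp only [smul_eq_mul, ← pow_two, (hsG s hs).1, (hsG s hs).2.1]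
      rw [hsq s hs, add_sub_cancel_right]
      exact hb2 z (by assumption) z' hz'2 s hs) s₂ hs₂
    simpa only [smul_eq_mul, ← pow_two, hz2, ne_eq, OfNat.ofNat_ne_zero, not_false_eq_true,
      zero_pow, sub_zero] using h1
  -- On the circle G − G' = (G² − G'²)/(G + G'), whose denominator is at least `m` in modulus.
  have hA2 : ‖G s₂‖ ≤ (t + X) / m := by
    have h1 := norm_le_of_forall_mem_sphere (hG.sub hG') (C := (t + X) / m) (fun s hs => by
      rw [Pi.sub_apply, (hsG s hs).1, (hsG s hs).2.1, le_div_iff₀ hm0]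
      have h2 : m ≤ ‖g (z, s) + g (z', s)‖ := by
        have e1 := hb1 z hz1 s hs
        have e2 := hb1 z' hz'1 s hs
        have e3 := hmle s hs
        have e4 : 2 * g (z₀, s) = (g (z, s) + g (z', s)) - (g (z, s) - g (z₀, s))
          - (g (z', s) - g (z₀, s)) := by ring
        have e5 : ‖2 * g (z₀, s)‖ ≤ ‖g (z, s) + g (z', s)‖ + ‖g (z, s) - g (z₀, s)‖ +
            ‖g (z', s) - g (z₀, s)‖ := by
          rw [e4]
          exact (norm_sub_le _ _).trans (by gcongr; exact norm_sub_le _ _)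
        rw [norm_mul, Complex.norm_ofNat] at e5
        linarith
      calc ‖g (z, s) - g (z', s)‖ * m ≤ ‖g (z, s) - g (z', s)‖ * ‖g (z, s) + g (z', s)‖ := by
            gcongr
        _ = ‖g (z, s) ^ 2 - g (z', s) ^ 2‖ := by rw [← norm_mul]; congr 1; ring
        _ ≤ t + X := by
            rw [hsq s hs]
            exact (norm_add_le _ _).trans (by gcongr; exact hb2 z (by assumption) z' hz'2 s hs))
      s₂ hs₂
    rwa [Pi.sub_apply, hz2, sub_zero] at h1
  have hA3 : X ≤ t + ((t + X) / m) ^ 2 := by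
    have e1 : wildFun (ζ z) - wildFun (ζ z') =
        G s₂ ^ 2 - (G s₂ ^ 2 - (wildFun (ζ z) - wildFun (ζ z'))) := by ring
    have e2 : X ≤ ‖G s₂ ^ 2‖ + ‖G s₂ ^ 2 - (wildFun (ζ z) - wildFun (ζ z'))‖ := by
      rw [hX]
      conv_lhs => rw [e1]
      exact norm_sub_le _ _
    rw [norm_pow] at e2
    have e3 : ‖G s₂‖ ^ 2 ≤ ((t + X) / m) ^ 2 := by gcongr
    linarith
  -- Since t + X ≤ m²/3, the quadratic term is absorbed: X ≤ t + (t + X)/3, that is X ≤ 2t.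
  have hA4 : ((t + X) / m) ^ 2 ≤ (t + X) / 3 := by
    rw [div_pow, div_le_iff₀ (by positivity)]
    nlinarith
  rw [show 2 * L * ‖z - z'‖ = 2 * t by rw [ht]; ring]
  linarith

end IsFoliatedRoot

end ContinuationOfRoots

/-! ### Global continuation of the root: the extension domain is everything. -/

section ContinuationOfRoots

open Complex Filter Topology

/-- A holomorphic function with nonvanishing derivative is a local homeomorphism. -/
theorem exists_openPartialHomeomorph {ζ : ℂ → ℂ} {z : ℂ} (hζ : AnalyticAt ℂ ζ z)
    (hd : deriv ζ z ≠ 0) : ∃ e : OpenPartialHomeomorph ℂ ℂ, z ∈ e.source ∧ ∀ w, e w = ζ w := by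
  have hs := hζ.hasStrictDerivAt.hasStrictFDerivAt_equiv hd
  exact ⟨hs.toOpenPartialHomeomorph ζ, hs.mem_toOpenPartialHomeomorph_source, fun w => by
    rw [hs.toOpenPartialHomeomorph_coe]⟩

/-- `wildFun ∘ ζ` is not Lipschitz at a point of the closed lower half plane. -/
theorem false_of_lipschitz {ζ : ℂ → ℂ} {z : ℂ} (hζ : AnalyticAt ℂ ζ z) (hd : deriv ζ z ≠ 0)
    (hi : (ζ z).im ≤ 0) {e : OpenPartialHomeomorph ℂ ℂ} (he : z ∈ e.source)
    (heq : ∀ w, e w = ζ w) {S : Set ℂ} {L : ℝ}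
    (hL : ∀ w ∈ S, ‖wildFun (ζ w) - wildFun (ζ z)‖ ≤ L * ‖w - z‖)
    (hS : ∀ᶠ t : ℝ in 𝓝[>] 0, e.symm (ζ z + t) ∈ S) : False := by
  have hzt : ζ z ∈ e.target := heq z ▸ e.map_source he
  have hsymm : e.symm (ζ z) = z := by rw [← heq z, e.left_inv he]
  have hfun : (e : ℂ → ℂ) = ζ := funext heq
  have hder : HasDerivAt e (deriv ζ z) (e.symm (ζ z)) := by
    rw [hsymm, hfun]
    exact hζ.differentiableAt.hasDerivAt
  -- The local inverse of ζ satisfies a Lipschitz bound at ζ(z), so the hypothesis would make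
  -- `wildFun` itself Lipschitz there along the displacements t > 0.
  have hO := (e.hasDerivAt_symm hzt hd hder).isBigO_sub
  obtain ⟨C, hC⟩ := hO.bound
  have htend : Tendsto (fun t : ℝ => ζ z + t) (𝓝[>] 0) (𝓝 (ζ z)) := by
    have : Tendsto (fun t : ℝ => ζ z + t) (𝓝 0) (𝓝 (ζ z + (0 : ℝ))) := by
      refine Continuous.tendsto ?_ 0
      fun_prop
    rw [ofReal_zero, add_zero] at this
    exact this.mono_left nhdsWithin_le_nhds
  have hev := (hS.and (htend.eventually hC)).and (htend.eventually (e.open_target.mem_nhds hzt))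
  obtain ⟨δ, hδ, hb⟩ := (nhdsGT_basis (0 : ℝ)).eventually_iff.1 hev
  obtain ⟨t, ht0, htδ, ht⟩ := exists_lt_norm_wildFun_sub hi (|L| * C) δ hδ
  obtain ⟨⟨h1, h2⟩, h3⟩ := hb ⟨ht0, htδ⟩
  have h4 := hL _ h1
  rw [← heq (e.symm _), e.right_inv h3] at h4
  rw [hsymm, add_sub_cancel_left, norm_real, Real.norm_of_nonneg ht0.le] at h2
  have h5 : L * ‖e.symm (ζ z + t) - z‖ ≤ |L| * (C * t) := by
    calc L * ‖e.symm (ζ z + t) - z‖ ≤ |L| * ‖e.symm (ζ z + t) - z‖ := by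
          gcongr; exact le_abs_self L
      _ ≤ |L| * (C * t) := by gcongr
  linarith

theorem isPreconnected_ball_diff_singleton (z : ℂ) (r : ℝ) : IsPreconnected (ball z r \ {z}) := by
  have h : ball z r \ {z} =
      (fun p : ℝ × ℝ => z + p.1 * exp (p.2 * I)) '' (Ioo 0 r ×ˢ univ) := by
    ext w
    constructor
    · rintro ⟨h1, h2⟩
      have h3 : w - z ≠ 0 := sub_ne_zero.2 h2
      refine ⟨(‖w - z‖, arg (w - z)), ⟨⟨norm_pos_iff.2 h3, ?_⟩, mem_univ _⟩, ?_⟩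
      · rwa [mem_ball, dist_eq_norm] at h1
      · simp [norm_mul_exp_arg_mul_I]
    · rintro ⟨⟨a, b⟩, ⟨⟨h1, h2⟩, -⟩, rfl⟩
      refine ⟨?_, ?_⟩
      · simpa [dist_eq_norm, norm_exp_ofReal_mul_I, abs_of_pos h1] using h2
      · simp [exp_ne_zero, h1.ne']
  rw [h]
  exact (((convex_Ioo 0 r).prod convex_univ).isPreconnected).image _ (by fun_prop)

theorem closure_ball_inter_upper {p : ℂ} {δ : ℝ} {w : ℂ} (hw : w ∈ ball p δ) (hi : 0 ≤ w.im) :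
    w ∈ closure (ball p δ ∩ {w | 0 < w.im}) := by
  refine isOpen_ball.inter_closure ⟨hw, ?_⟩
  rw [closure_setOfPred_lt_im]
  exact hi

namespace IsFoliatedRoot

variable {ρ R : ℝ} {A : Set ℂ} {ζ : ℂ → ℂ} {h g : ℂ × ℂ → ℂ}

/-- The interior of the set of points at which the slice of `g` extends. -/
def extensionDomain (ρ R : ℝ) (g : ℂ × ℂ → ℂ) : Set ℂ :=
  interior {z | z ∈ ball 0 R ∧ ExtendsAt g ρ z}

theorem analyticAt (H : IsFoliatedRoot ρ R A ζ h g) {z : ℂ} (hz : z ∈ ball 0 R) :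
    AnalyticAt ℂ ζ z := H.diff_ζ.analyticAt (isOpen_ball.mem_nhds hz)

theorem extendsAt_of_closure (H : IsFoliatedRoot ρ R A ζ h g) {z : ℂ} (hz : z ∈ ball 0 R)
    (hc : z ∈ closure {z | z ∈ ball 0 R ∧ ExtendsAt g ρ z}) : ExtendsAt g ρ z :=
  extendsAt_of_mem_closure H.rho_lt H.isOpen_A H.mem_A isOpen_ball H.cont_g hz (H.diff_slice hz)
    (closure_mono (fun _ hw => hw.2) hc)

/-- Over the upper half plane `g` is holomorphic in both variables, so Hartogs continuation applies
to `g` itself. -/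
theorem extendsAt_of_upper (H : IsFoliatedRoot ρ R A ζ h g) {O : Set ℂ} (hO : IsOpen O)
    (hOc : IsPreconnected O) (hOB : O ⊆ ball 0 R) (hOi : ∀ z ∈ O, 0 < (ζ z).im) {z₁ : ℂ}
    (hz₁ : z₁ ∈ O) (hT : z₁ ∈ extensionDomain ρ R g) : ∀ z ∈ O, ExtendsAt g ρ z :=
  extendsAt_of_preconnected H.rho_lt H.isOpen_A H.mem_A hO hOc
    (H.diff_g.mono (prod_mono_left fun z hz => ⟨hOB hz, hOi z hz⟩)) hz₁
    (mem_of_superset (mem_interior_iff_mem_nhds.1 hT) fun _ hz => hz.2)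

theorem false_of_lipschitz_mem (H : IsFoliatedRoot ρ R A ζ h g) {z₀ z₁ : ℂ} {r L : ℝ}
    (hz₁ : z₁ ∈ ball 0 R) (hd : deriv ζ z₁ ≠ 0) (hi : (ζ z₁).im ≤ 0) (hr : z₁ ∈ ball z₀ r)
    (hL : ∀ z ∈ ball z₀ r, ∀ z' ∈ ball z₀ r, ExtendsAt g ρ z → ExtendsAt g ρ z' →
      ‖wildFun (ζ z) - wildFun (ζ z')‖ ≤ L * ‖z - z'‖)
    (hT : z₁ ∈ extensionDomain ρ R g) : False := by
  obtain ⟨e, he, heq⟩ := exists_openPartialHomeomorph (H.analyticAt hz₁) hd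
  have hT' := mem_interior_iff_mem_nhds.1 hT
  have hzt : ζ z₁ ∈ e.target := heq z₁ ▸ e.map_source he
  have hsymm : e.symm (ζ z₁) = z₁ := by rw [← heq z₁, e.left_inv he]
  refine false_of_lipschitz (H.analyticAt hz₁) hd hi he heq
    (S := {z | z ∈ ball z₀ r ∧ ExtendsAt g ρ z}) (L := L)
    (fun w hw => hL w hw.1 z₁ hr hw.2 (mem_of_mem_nhds hT').2) ?_
  have hc : Tendsto (fun t : ℝ => e.symm (ζ z₁ + t)) (𝓝 0) (𝓝 z₁) := by
    have h1 : ContinuousAt (fun t : ℝ => e.symm (ζ z₁ + t)) 0 := by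
      refine ContinuousAt.comp (f := fun t : ℝ => ζ z₁ + (t : ℂ)) ?_ (by fun_prop)
      simpa using e.symm.continuousAt hzt
    have h2 := h1.tendsto
    rwa [ofReal_zero, add_zero, hsymm] at h2
  refine (hc.mono_left nhdsWithin_le_nhds).eventually ?_
  filter_upwards [isOpen_ball.mem_nhds hr, hT'] with w hw1 hw2 using ⟨hw1, hw2.2⟩

/-- The closedness step away from critical points of ζ. Only a slice with a zero over the closed
lower half plane resists direct extension, and it is excluded by finding a nearby point where
`wildFun ∘ ζ` would be Lipschitz along a horizontal segment. -/
theorem mem_extensionDomain_of_deriv_ne (H : IsFoliatedRoot ρ R A ζ h g)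
    (hh : ∀ z ∈ ball 0 R, ExtendsAt h ρ z) {z₀ : ℂ} (hz₀ : z₀ ∈ ball 0 R)
    (hc : z₀ ∈ closure (extensionDomain ρ R g)) (hd : deriv ζ z₀ ≠ 0) :
    z₀ ∈ extensionDomain ρ R g := by
  have hB : ball (0 : ℂ) R ∈ 𝓝 z₀ := isOpen_ball.mem_nhds hz₀
  have hζc : ContinuousAt ζ z₀ := (H.analyticAt hz₀).continuousAt
  by_cases hi : 0 < (ζ z₀).im
  · have hev : ∀ᶠ z in 𝓝 z₀, 0 < (ζ z).im :=
      (continuous_im.continuousAt.comp hζc).eventually (lt_mem_nhds hi)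
    obtain ⟨δ, hδ, hsub⟩ := Metric.mem_nhds_iff.1 (inter_mem hB hev)
    obtain ⟨z₁, hz₁, hz₁T⟩ := mem_closure_iff.1 hc _ isOpen_ball (mem_ball_self hδ)
    have := H.extendsAt_of_upper isOpen_ball isPreconnected_ball (fun z hz => (hsub hz).1)
      (fun z hz => (hsub hz).2) hz₁ hz₁T
    exact mem_interior_iff_mem_nhds.2 (mem_of_superset (ball_mem_nhds z₀ hδ)
      fun z hz => ⟨(hsub hz).1, this z hz⟩)
  rw [not_lt] at hi
  obtain ⟨G₀, hG₀, he₀⟩ := H.extendsAt_of_closure hz₀ (closure_mono interior_subset hc)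
  by_cases hzero : ∀ s ∈ closedBall (0 : ℂ) 1, G₀ s ≠ 0
  · refine mem_interior_iff_mem_nhds.2 ?_
    filter_upwards [hB, H.eventually_extendsAt hh hz₀ hG₀ he₀ hzero] with z h1 h2 using ⟨h1, h2⟩
  exfalso
  push Not at hzero
  obtain ⟨s₀, hs₀, h0⟩ := hzero
  obtain ⟨r, hr, L, hL⟩ := H.exists_lipschitz hz₀ hi hG₀ he₀ hs₀ h0
  obtain ⟨e, he, heq⟩ := exists_openPartialHomeomorph (H.analyticAt hz₀) hd
  have hdev : ∀ᶠ z in 𝓝 z₀, deriv ζ z ≠ 0 :=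
    (H.analyticAt hz₀).deriv.continuousAt.eventually_ne hd
  obtain ⟨W, hWsub, hWo, hz₀W⟩ := _root_.mem_nhds_iff.1
    (inter_mem (inter_mem hB hdev) (ball_mem_nhds z₀ hr))
  have hzt : ζ z₀ ∈ e.target := heq z₀ ▸ e.map_source he
  have hsymm : e.symm (ζ z₀) = z₀ := by rw [← heq z₀, e.left_inv he]
  obtain ⟨δ, hδ, hδsub⟩ := Metric.isOpen_iff.1 (e.isOpen_inter_preimage_symm hWo) (ζ z₀)
    ⟨hzt, by rw [mem_preimage, hsymm]; exact hz₀W⟩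
  obtain ⟨z₁, ⟨⟨hz₁s, hz₁b⟩, hz₁W⟩, hz₁T⟩ := mem_closure_iff.1 hc _
    ((e.isOpen_inter_preimage (isOpen_ball (x := ζ z₀) (ε := δ))).inter hWo)
    ⟨⟨he, by rw [mem_preimage, heq]; exact mem_ball_self hδ⟩, hz₀W⟩
  rw [mem_preimage, heq] at hz₁b
  by_cases hi₁ : (ζ z₁).im ≤ 0
  · exact H.false_of_lipschitz_mem (hWsub hz₁W).1.1 (hWsub hz₁W).1.2 hi₁ (hWsub hz₁W).2 hL hz₁T
  rw [not_le] at hi₁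
  -- If `z₁` lies over the upper half plane, extendability spreads over the whole half disk `D` and
  -- then, by closedness, to its real boundary points.
  set D : Set ℂ := ball (ζ z₀) δ ∩ {w | 0 < w.im} with hD
  have hDt : D ⊆ e.target := fun w hw => (hδsub hw.1).1
  have hDo : IsOpen D := isOpen_ball.inter (isOpen_lt continuous_const continuous_im)
  have hDc : IsPreconnected D :=
    ((convex_ball _ _).inter (convex_halfSpace_im_gt 0)).isPreconnected
  have hOo : IsOpen (e.symm '' D) := by
    rw [e.symm_image_eq_source_inter_preimage hDt]
    exact e.isOpen_inter_preimage hDo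
  have hext : ∀ z ∈ e.symm '' D, ExtendsAt g ρ z := by
    refine H.extendsAt_of_upper hOo (hDc.image _ (e.continuousOn_symm.mono hDt)) ?_ ?_
      (z₁ := z₁) ⟨ζ z₁, ⟨hz₁b, hi₁⟩, by rw [← heq, e.left_inv hz₁s]⟩ hz₁T
    · rintro _ ⟨w, hw, rfl⟩
      exact (hWsub (hδsub hw.1).2).1.1
    · rintro _ ⟨w, hw, rfl⟩
      rw [← heq, e.right_inv (hDt hw)]
      exact hw.2
  have hext' : ∀ w ∈ ball (ζ z₀) δ, 0 ≤ w.im → ExtendsAt g ρ (e.symm w) := by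
    intro w hw hwi
    refine H.extendsAt_of_closure (hWsub (hδsub hw).2).1.1 ?_
    refine closure_mono (s := e.symm '' D) ?_ ?_
    · rintro _ ⟨v, hv, rfl⟩
      exact ⟨(hWsub (hδsub hv.1).2).1.1, hext _ ⟨v, hv, rfl⟩⟩
    · exact mem_closure_image (e.symm.continuousAt (hδsub hw).1)
        (closure_ball_inter_upper hw hwi)
  -- A point of the real axis in the ball: `wildFun` is wild at `p`, and the horizontal
  -- displacements from `p` stay on the real axis, where the slices extend. It is within δ of ζ(z₀)
  -- because Im ζ(z₀) ≤ 0 < Im ζ(z₁).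
  set p : ℂ := ⟨(ζ z₀).re, 0⟩ with hp
  have hpb : p ∈ ball (ζ z₀) δ := by
    have h1 : ‖p - ζ z₀‖ = |(ζ z₀).im| := by
      have : p - ζ z₀ = ((-(ζ z₀).im : ℝ) : ℂ) * I := by
        apply Complex.ext <;> simp [hp]
      rw [this, norm_mul, norm_I, mul_one, norm_real, Real.norm_eq_abs, abs_neg]
    have h2 := abs_im_le_norm (ζ z₁ - ζ z₀)
    rw [mem_ball, dist_eq_norm] at hz₁b ⊢
    rw [sub_im, abs_of_pos (by linarith)] at h2
    rw [h1, abs_of_nonpos hi]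
    linarith
  have hpW := hWsub (hδsub hpb).2
  have hpt := (hδsub hpb).1
  have hζp : ζ (e.symm p) = p := by rw [← heq, e.right_inv hpt]
  refine false_of_lipschitz (H.analyticAt hpW.1.1) hpW.1.2 (by rw [hζp]) (e.map_target hpt) heq
    (S := {z | z ∈ ball z₀ r ∧ ExtendsAt g ρ z}) (L := L)
    (fun w hw => hL w hw.1 _ hpW.2 hw.2 (hext' p hpb le_rfl)) ?_
  rw [hζp]
  have hc2 : Tendsto (fun t : ℝ => p + t) (𝓝 0) (𝓝 p) := by
    have : Tendsto (fun t : ℝ => p + t) (𝓝 0) (𝓝 (p + (0 : ℝ))) :=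
      Continuous.tendsto (by fun_prop) 0
    rwa [ofReal_zero, add_zero] at this
  filter_upwards [(hc2.mono_left nhdsWithin_le_nhds).eventually (isOpen_ball.mem_nhds hpb)]
    with t ht
  exact ⟨(hWsub (hδsub ht).2).2, hext' _ ht (by simp [hp])⟩

theorem eventually_deriv_ne (H : IsFoliatedRoot ρ R A ζ h g) {a b : ℂ} (ha : a ∈ ball 0 R)
    (hb : b ∈ ball 0 R) (hab : ζ a ≠ ζ b) {z₀ : ℂ} (hz₀ : z₀ ∈ ball 0 R) :
    ∀ᶠ z in 𝓝[≠] z₀, deriv ζ z ≠ 0 := by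
  refine (H.analyticAt hz₀).deriv.eventually_eq_zero_or_eventually_ne_zero.resolve_left
    fun hzero => hab ?_
  have han : AnalyticOnNhd ℂ (deriv ζ) (ball 0 R) := fun z hz => (H.analyticAt hz).deriv
  exact isOpen_ball.is_const_of_deriv_eq_zero isPreconnected_ball H.diff_ζ
    (han.eqOn_zero_of_preconnected_of_eventuallyEq_zero isPreconnected_ball hz₀ hzero) ha hb

/-- Critical points of ζ are isolated. The extension domain fills a connected punctured disk around
one, and the slice at the centre extends as a limit. -/
theorem mem_extensionDomain (H : IsFoliatedRoot ρ R A ζ h g)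
    (hh : ∀ z ∈ ball 0 R, ExtendsAt h ρ z) {a b : ℂ} (ha : a ∈ ball 0 R)
    (hb : b ∈ ball 0 R) (hab : ζ a ≠ ζ b) {z₀ : ℂ} (hz₀ : z₀ ∈ ball 0 R)
    (hc : z₀ ∈ closure (extensionDomain ρ R g)) : z₀ ∈ extensionDomain ρ R g := by
  have hB : ball (0 : ℂ) R ∈ 𝓝 z₀ := isOpen_ball.mem_nhds hz₀
  obtain ⟨δ, hδ, hsub⟩ := Metric.mem_nhds_iff.1 (inter_mem hB
    (eventually_nhdsWithin_iff.1 (H.eventually_deriv_ne ha hb hab hz₀)))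
  have hTo : IsOpen (extensionDomain ρ R g) := isOpen_interior
  have hpunct : ball z₀ δ \ {z₀} ⊆ extensionDomain ρ R g := by
    refine (isPreconnected_ball_diff_singleton z₀ δ).subset_of_closure_inter_subset hTo ?_ ?_
    · obtain ⟨z₁, hz₁, hz₁T⟩ := mem_closure_iff.1 hc _ isOpen_ball (mem_ball_self hδ)
      obtain ⟨z₂, hz₂, hne⟩ := ((isOpen_ball.inter hTo).mem_nhds ⟨hz₁, hz₁T⟩ |>
        fun h => (NormedField.nhdsNE_neBot z₁).nonempty_of_mem
          (inter_mem (nhdsWithin_le_nhds h) self_mem_nhdsWithin))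
      by_cases h1 : z₁ = z₀
      · exact ⟨z₂, ⟨hz₂.1, by rw [← h1]; exact hne⟩, hz₂.2⟩
      · exact ⟨z₁, ⟨hz₁, h1⟩, hz₁T⟩
    · rintro z ⟨hzc, hzb, hz⟩
      exact H.mem_extensionDomain_of_deriv_ne hh (hsub hzb).1 hzc ((hsub hzb).2 hz)
  have hz₀e : ExtendsAt g ρ z₀ := H.extendsAt_of_closure hz₀ (closure_mono interior_subset hc)
  refine mem_interior_iff_mem_nhds.2 (mem_of_superset (ball_mem_nhds z₀ hδ) fun z hz => ?_)
  by_cases h1 : z = z₀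
  · exact h1 ▸ ⟨hz₀, hz₀e⟩
  · exact interior_subset (hpunct ⟨hz, h1⟩)

/-- If the slices of `h` and `g` extend near the origin, then the boundary values of `g` over a
point of the lower half plane have a logarithm. -/
theorem hasLog (H : IsFoliatedRoot ρ R A ζ h g) {z₀ z₁ : ℂ} (hz₀ : z₀ ∈ ball 0 R)
    (hz₁ : z₁ ∈ ball 0 R) (hi₀ : 0 < (ζ z₀).im) (hi₁ : (ζ z₁).im ≤ 0)
    (hh : ∀ᶠ z in 𝓝 z₀, ExtendsAt h ρ z) (hg : ∀ᶠ z in 𝓝 z₀, ExtendsAt g ρ z) :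
    HasLog (fun s => g (z₁, s)) := by
  have hh' : ∀ z ∈ ball 0 R, ExtendsAt h ρ z :=
    extendsAt_of_preconnected H.rho_lt H.isOpen_A H.mem_A isOpen_ball isPreconnected_ball
      H.diff_h hz₀ hh
  have hab : ζ z₀ ≠ ζ z₁ := fun h => by rw [h] at hi₀; linarith
  have hall : ball 0 R ⊆ extensionDomain ρ R g := by
    refine isPreconnected_ball.subset_of_closure_inter_subset isOpen_interior ⟨z₀, hz₀, ?_⟩
      fun z hz => H.mem_extensionDomain hh' hz₀ hz₁ hab hz.2 hz.1
    refine mem_interior_iff_mem_nhds.2 ?_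
    filter_upwards [isOpen_ball.mem_nhds hz₀, hg] with z h1 h2 using ⟨h1, h2⟩
  obtain ⟨G, hG, he⟩ := (interior_subset (hall hz₁)).2
  by_cases hzero : ∀ s ∈ closedBall (0 : ℂ) 1, G s ≠ 0
  · have hGc := hG.continuousOn
    rw [closure_ball _ one_ne_zero] at hGc
    convert hasLog_of_closedBall hGc hzero using 1
    ext s
    rw [he s (by rw [Circle.norm_coe]; exact H.rho_lt) (Circle.norm_coe s).le]
  exfalso
  push Not at hzero
  obtain ⟨s₀, hs₀, h0⟩ := hzero
  obtain ⟨r, hr, L, hL⟩ := H.exists_lipschitz hz₁ hi₁ hG he hs₀ h0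
  have hne := eventually_nhdsWithin_iff.1 (H.eventually_deriv_ne hz₀ hz₁ hab hz₁)
  have hmap : 𝓝 (ζ z₁) ≤ map ζ (𝓝 z₁) := by
    refine (H.analyticAt hz₁).eventually_constant_or_nhds_le_map_nhds.resolve_left fun hc => ?_
    have h1 : ∀ᶠ z in 𝓝[≠] z₁, deriv ζ z = 0 := by
      have h2 : ζ =ᶠ[𝓝 z₁] fun _ => ζ z₁ := hc
      have h3 := h2.deriv
      simp only [deriv_const'] at h3
      exact nhdsWithin_le_nhds h3
    obtain ⟨z, hz1, hz2⟩ := (h1.and (H.eventually_deriv_ne hz₀ hz₁ hab hz₁)).exists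
    exact hz2 hz1
  have hW : ζ '' {z | (z ∈ ball 0 R ∧ z ∈ ball z₁ r) ∧ (z ∈ ({z₁}ᶜ : Set ℂ) → deriv ζ z ≠ 0)} ∈
      𝓝 (ζ z₁) :=
    hmap (image_mem_map (((isOpen_ball.eventually_mem hz₁).and
      (isOpen_ball.eventually_mem (mem_ball_self hr))).and hne))
  obtain ⟨δ, hδ, hb⟩ := Metric.mem_nhds_iff.1 hW
  -- The open mapping property gives a point over the lower half plane; moving strictly down makes
  -- it differ from `z₁`, so that it is not critical.
  have hp : ζ z₁ - (δ / 2 : ℝ) * I ∈ ball (ζ z₁) δ := by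
    rw [mem_ball, dist_eq_norm, sub_sub_cancel_left, norm_neg, norm_mul, norm_I, mul_one,
      norm_real, Real.norm_of_nonneg (by positivity)]
    linarith
  obtain ⟨z, ⟨⟨hz1, hz2⟩, hz3⟩, hz4⟩ := hb hp
  have him : (ζ z).im = (ζ z₁).im - δ / 2 := by rw [hz4]; simp
  refine H.false_of_lipschitz_mem hz1 (hz3 ?_) (by rw [him]; linarith) hz2 hL (hall hz1)
  rintro rfl
  linarith

end IsFoliatedRoot

end ContinuationOfRoots

/-! ### The principal square root. -/

section SquareRoot

open Complex

/-- The principal branch of the square root. -/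
noncomputable def csqrt (u : ℂ) : ℂ := exp (log u / 2)

theorem csqrt_sq {u : ℂ} (hu : u ≠ 0) : csqrt u ^ 2 = u := by
  rw [csqrt, ← exp_nat_mul, Nat.cast_ofNat, mul_div_cancel₀ _ two_ne_zero, exp_log hu]

theorem csqrt_ne_zero (u : ℂ) : csqrt u ≠ 0 := exp_ne_zero _

theorem csqrt_re_pos {u : ℂ} (hu : u ∈ slitPlane) : 0 < (csqrt u).re := by
  rw [csqrt, exp_re]
  have h1 := neg_pi_lt_arg u
  have h2 := lt_of_le_of_ne (arg_le_pi u) (mem_slitPlane_iff_arg.1 hu).1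
  refine mul_pos (Real.exp_pos _) (Real.cos_pos_of_mem_Ioo ⟨?_, ?_⟩) <;>
    rw [Complex.div_ofNat_im, log_im] <;> linarith

theorem sq_mem_slitPlane {v : ℂ} (hv : 0 < v.re) : v ^ 2 ∈ slitPlane := by
  rw [mem_slitPlane_iff, pow_two, mul_re, mul_im]
  by_cases h : v.im = 0
  · left
    rw [h]
    nlinarith
  · right
    intro h2
    have : v.re * v.im = 0 := by linarith
    rcases mul_eq_zero.1 this with h3 | h3
    · linarith
    · exact h h3

theorem eq_of_sq_eq_sq_of_re_pos {v w : ℂ} (hv : 0 < v.re) (hw : 0 < w.re) (h : v ^ 2 = w ^ 2) :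
    v = w := by
  rcases sq_eq_sq_iff_eq_or_eq_neg.1 h with h | h
  · exact h
  · rw [h, neg_re] at hv
    linarith

theorem csqrt_sq_of_re_pos {v : ℂ} (hv : 0 < v.re) : csqrt (v ^ 2) = v :=
  eq_of_sq_eq_sq_of_re_pos (csqrt_re_pos (sq_mem_slitPlane hv)) hv
    (csqrt_sq (slitPlane_ne_zero (sq_mem_slitPlane hv)))

theorem contDiffAt_csqrt {n : WithTop ℕ∞} {u : ℂ} (hu : u ∈ slitPlane) : ContDiffAt ℂ n csqrt u :=
  ((contDiffAt_log hu).div_const 2).cexp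

theorem continuousOn_csqrt : ContinuousOn csqrt slitPlane := fun _ hu =>
  (contDiffAt_csqrt (n := 1) hu).continuousAt.continuousWithinAt

theorem csqrt_one : csqrt 1 = 1 := by simp [csqrt]

end SquareRoot

/-! ### The complex structure of the surface. -/

section Surface

open Complex

/-- The underlying set of the surface, in the coordinates `(z, w)`. -/
def surfaceSet : Set (ℂ × ℂ) := {p | ‖p.1‖ < 1 ∧ ‖p.2‖ < 1 ∧ (0 < p.1.im ∨ p.2 ≠ 0)}

theorem isOpen_surfaceSet : IsOpen surfaceSet := by
  refine (isOpen_lt (continuous_norm.comp continuous_fst) continuous_const).inter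
    ((isOpen_lt (continuous_norm.comp continuous_snd) continuous_const).inter (IsOpen.union ?_ ?_))
  · exact isOpen_lt continuous_const (continuous_im.comp continuous_fst)
  · exact isOpen_ne_fun continuous_snd continuous_const

/-- The surface: a domain in the plane with a complex structure in which `z` and
`w ^ 2 - wildFun z` are holomorphic. -/
abbrev WildSurface : Type := surfaceSet

instance : Nonempty WildSurface := ⟨⟨(0, 1 / 2), by norm_num [surfaceSet]⟩⟩

/-- The inclusion of the surface in the plane. -/
noncomputable def surfaceIncl : OpenPartialHomeomorph WildSurface (ℂ × ℂ) :=
  isOpen_surfaceSet.isOpenEmbedding_subtypeVal.toOpenPartialHomeomorph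

theorem surfaceIncl_target : surfaceIncl.target = surfaceSet := by
  simp [surfaceIncl]

theorem surfaceIncl_symm_val {p : ℂ × ℂ} (hp : p ∈ surfaceSet) : (surfaceIncl.symm p).1 = p :=
  surfaceIncl.right_inv (by rwa [surfaceIncl_target])

/-- The map `(z, w) ↦ (z, w ^ 2 - wildFun z)` as a homeomorphism on the half plane
`0 < Re (w / e)`. -/
noncomputable def squareChart (e : ℂ) : OpenPartialHomeomorph (ℂ × ℂ) (ℂ × ℂ) where
  toFun p := (p.1, p.2 ^ 2 - wildFun p.1)
  invFun q := (q.1, e * csqrt ((q.2 + wildFun q.1) / e ^ 2))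
  source := {p | 0 < (p.2 / e).re}
  target := {q | (q.2 + wildFun q.1) / e ^ 2 ∈ slitPlane}
  map_source' p hp := by
    have : (p.2 ^ 2 - wildFun p.1 + wildFun p.1) / e ^ 2 = (p.2 / e) ^ 2 := by ring
    change _ ∈ slitPlane
    rw [this]
    exact sq_mem_slitPlane hp
  map_target' q hq := by
    have he : e ≠ 0 := by
      rintro rfl
      simp at hq
    change 0 < (e * csqrt _ / e).re
    rw [mul_div_cancel_left₀ _ he]
    exact csqrt_re_pos hq
  left_inv' p hp := by
    have he : e ≠ 0 := by
      rintro rfl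
      simp at hp
    have : (p.2 ^ 2 - wildFun p.1 + wildFun p.1) / e ^ 2 = (p.2 / e) ^ 2 := by ring
    ext1
    · rfl
    · simp only
      rw [this, csqrt_sq_of_re_pos hp, mul_div_cancel₀ _ he]
  right_inv' q hq := by
    have he : e ≠ 0 := by
      rintro rfl
      simp at hq
    ext1
    · rfl
    · simp only
      rw [mul_pow, csqrt_sq (slitPlane_ne_zero hq), mul_div_cancel₀ _ (pow_ne_zero 2 he)]
      ring
  open_source := isOpen_lt continuous_const (by fun_prop)
  open_target := by
    have := continuous_wildFun
    exact isOpen_slitPlane.preimage (by fun_prop)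
  continuousOn_toFun := by
    have := continuous_wildFun
    fun_prop
  continuousOn_invFun := by
    have := continuous_wildFun
    refine continuousOn_fst.prodMk (continuousOn_const.mul ?_)
    exact continuousOn_csqrt.comp (by fun_prop) (fun q hq => hq)

/-- The chart `(z, w)` of the surface over the upper half plane. -/
noncomputable def upperChart : OpenPartialHomeomorph WildSurface (ℂ × ℂ) :=
  surfaceIncl ≫ₕ OpenPartialHomeomorph.ofSet {p : ℂ × ℂ | 0 < p.1.im}
    (isOpen_lt continuous_const (continuous_im.comp continuous_fst))

/-- The charts `(z, w ^ 2 - wildFun z)` of the surface. -/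
noncomputable def branchChart (e : ℂ) : OpenPartialHomeomorph WildSurface (ℂ × ℂ) :=
  surfaceIncl ≫ₕ squareChart e

theorem upperChart_source : upperChart.source = {x | 0 < x.1.1.im} := by
  ext x
  simp [upperChart, surfaceIncl]

theorem branchChart_source (e : ℂ) : (branchChart e).source = {x | 0 < (x.1.2 / e).re} := by
  ext x
  simp [branchChart, surfaceIncl, squareChart]

theorem upperChart_apply (x : WildSurface) : upperChart x = x.1 := rfl

theorem branchChart_apply (e : ℂ) (x : WildSurface) :
    branchChart e x = (x.1.1, x.1.2 ^ 2 - wildFun x.1.1) := rfl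

/-- Points with w = 0 lie over the upper half plane, where `upperChart` serves; around any other
point squaring is injective on the half plane Re(w'/w) > 0. -/
noncomputable instance : ChartedSpace (ℂ × ℂ) WildSurface where
  atlas := insert upperChart (range branchChart)
  chartAt x := open scoped Classical in if x.1.2 = 0 then upperChart else branchChart x.1.2
  mem_chart_source x := by
    by_cases h : x.1.2 = 0
    · rw [if_pos h, upperChart_source]
      exact x.2.2.2.resolve_right (fun h' => h' h)
    · rw [if_neg h, branchChart_source, mem_ofPred_eq, div_self h]
      exact one_pos
  chart_mem_atlas x := by
    by_cases h : x.1.2 = 0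
    · rw [if_pos h]; exact mem_insert _ _
    · rw [if_neg h]; exact mem_insert_of_mem _ (mem_range_self _)

theorem chartAt_of_eq_zero {x : WildSurface} (h : x.1.2 = 0) :
    chartAt (ℂ × ℂ) x = upperChart := if_pos h

theorem chartAt_of_ne_zero {x : WildSurface} (h : x.1.2 ≠ 0) :
    chartAt (ℂ × ℂ) x = branchChart x.1.2 := if_neg h

theorem contDiffOn_wildFun : ContDiffOn ℂ ω wildFun {z | 0 < z.im} :=
  differentiableOn_wildFun.contDiffOn (isOpen_lt continuous_const continuous_im)

theorem contDiffAt_wildFun_fst {p : ℂ × ℂ} (hp : 0 < p.1.im) :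
    ContDiffAt ℂ ω (fun p : ℂ × ℂ => wildFun p.1) p :=
  ContDiffAt.comp (g := wildFun) (f := Prod.fst) p (contDiffOn_wildFun.contDiffAt
    ((isOpen_lt continuous_const continuous_im).mem_nhds hp)) contDiffAt_fst

theorem chart_symm_fst {e : OpenPartialHomeomorph WildSurface (ℂ × ℂ)}
    (he : e ∈ atlas (ℂ × ℂ) WildSurface) {q : ℂ × ℂ} (hq : q ∈ e.target) :
    (e.symm q).1.1 = q.1 := by
  have h := e.right_inv hq
  rcases he with rfl | ⟨a, rfl⟩
  · rw [upperChart_apply] at h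
    rw [h]
  · rw [branchChart_apply] at h
    exact (Prod.ext_iff.1 h).1

theorem branchChart_symm_snd {a : ℂ} {q : ℂ × ℂ} (hq : q ∈ (branchChart a).target) :
    ((branchChart a).symm q).1.2 = a * csqrt ((q.2 + wildFun q.1) / a ^ 2) ∧
      (q.2 + wildFun q.1) / a ^ 2 ∈ slitPlane := by
  have h : q ∈ (squareChart a).target ∧ (squareChart a).symm q ∈ surfaceSet := by
    rw [branchChart, OpenPartialHomeomorph.trans_target, surfaceIncl_target] at hq
    exact hq
  refine ⟨?_, h.1⟩
  change (surfaceIncl.symm ((squareChart a).symm q)).1.2 = _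
  rw [surfaceIncl_symm_val h.2]
  rfl

/-- All branch charts restrict the same map, so transitions between them are the identity. A
transition with `upperChart` lives over Im z > 0, where `wildFun` is holomorphic. -/
instance : IsManifold 𝓘(ℂ, ℂ × ℂ) ω WildSurface := by
  refine isManifold_of_contDiffOn _ _ _ fun e e' he he' => ?_
  simp only [modelWithCornersSelf_coe, modelWithCornersSelf_coe_symm, Function.id_comp,
    Function.comp_id, preimage_id, range_id, inter_univ]
  intro q hq
  refine ContDiffAt.contDiffWithinAt ?_
  have hnhds := (e.symm ≫ₕ e').open_source.mem_nhds hq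
  have hq' : ∀ q ∈ (e.symm ≫ₕ e').source, q ∈ e.target ∧ e.symm q ∈ e'.source := by
    intro q hq
    rw [OpenPartialHomeomorph.trans_source] at hq
    exact hq
  have hfst := fun q hq => chart_symm_fst he (hq' q hq).1
  rcases he with rfl | ⟨a, rfl⟩
  · have hval : ∀ q ∈ (upperChart.symm ≫ₕ e').source, (upperChart.symm q).1 = q := fun q hq =>
      upperChart.right_inv (hq' q hq).1
    have him : 0 < q.1.im := by
      have h := upperChart.map_target (hq' q hq).1
      rw [upperChart_source, mem_ofPred_eq, hval q hq] at h
      exact h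
    rcases he' with rfl | ⟨b, rfl⟩
    · refine contDiffAt_id.congr_of_eventuallyEq ?_
      filter_upwards [hnhds] with p hp
      exact hval p hp
    · refine (contDiffAt_fst.prodMk ((contDiffAt_snd.pow 2).sub
        (contDiffAt_wildFun_fst him))).congr_of_eventuallyEq ?_
      filter_upwards [hnhds] with p hp
      change branchChart b (upperChart.symm p) = _
      rw [branchChart_apply, hval p hp]
  · rcases he' with rfl | ⟨b, rfl⟩
    · have him : 0 < q.1.im := by
        have h := (hq' q hq).2
        rw [upperChart_source, mem_ofPred_eq, hfst q hq] at h
        exact h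
      have hsl := (branchChart_symm_snd (hq' q hq).1).2
      refine (contDiffAt_fst.prodMk (contDiffAt_const.mul (ContDiffAt.comp q
        (g := csqrt) (f := fun q : ℂ × ℂ => (q.2 + wildFun q.1) / a ^ 2) (contDiffAt_csqrt hsl)
        ((contDiffAt_snd.add (contDiffAt_wildFun_fst him)).div_const (a ^ 2))))).congr_of_eventuallyEq
          (f := fun q : ℂ × ℂ => (q.1, a * csqrt ((q.2 + wildFun q.1) / a ^ 2))) ?_
      filter_upwards [hnhds] with p hp
      change upperChart ((branchChart a).symm p) = _
      rw [upperChart_apply]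
      ext1
      · exact hfst p hp
      · exact (branchChart_symm_snd (hq' p hp).1).1
    · refine contDiffAt_id.congr_of_eventuallyEq ?_
      filter_upwards [hnhds] with p hp
      exact (branchChart a).right_inv (hq' p hp).1

/-- The projection of the surface to the disk. -/
def surfaceProj (x : WildSurface) : ℂ := x.1.1

/-- The fibre coordinate of the surface. -/
def fibreCoord (x : WildSurface) : ℂ := x.1.2

theorem continuous_fibreCoord : Continuous fibreCoord :=
  continuous_snd.comp continuous_subtype_val

theorem isSubmersion_surfaceProj :
    Manifold.IsSubmersion 𝓘(ℂ, ℂ × ℂ) 𝓘(ℂ, ℂ) ω surfaceProj := by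
  refine ⟨ℂ, inferInstance, inferInstance, fun x => ?_⟩
  refine Manifold.IsSubmersionAtOfComplement.mk_of_charts (ContinuousLinearEquiv.refl ℂ (ℂ × ℂ))
    (chartAt (ℂ × ℂ) x) (OpenPartialHomeomorph.refl ℂ) (mem_chart_source _ x) (mem_univ _)
    (IsManifold.chart_mem_maximalAtlas x) ?_ (fun _ _ => mem_univ _) ?_
  · exact IsManifold.chart_mem_maximalAtlas (I := 𝓘(ℂ, ℂ)) (n := ω) (0 : ℂ)
  · intro q hq
    have hq' : q ∈ (chartAt (ℂ × ℂ) x).target := by simpa using hq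
    exact chart_symm_fst (chart_mem_atlas _ x) hq'

theorem mdifferentiableAt_proj_coord {x : WildSurface} (h : 0 < (surfaceProj x).im) :
    MDifferentiableAt 𝓘(ℂ, ℂ × ℂ) 𝓘(ℂ, ℂ × ℂ) (fun x : WildSurface => x.1) x :=
  mdifferentiableAt_atlas (e := upperChart) (mem_insert _ _) (by rwa [upperChart_source])

theorem mdifferentiableAt_fibreCoord {x : WildSurface} (h : 0 < (surfaceProj x).im) :
    MDifferentiableAt 𝓘(ℂ, ℂ × ℂ) 𝓘(ℂ, ℂ) fibreCoord x :=
  MDifferentiableAt.comp x (g := (Prod.snd : ℂ × ℂ → ℂ)) (I' := 𝓘(ℂ, ℂ × ℂ))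
    differentiableAt_snd.mdifferentiableAt (mdifferentiableAt_proj_coord h)

theorem mdifferentiable_sq_sub_wildFun :
    MDifferentiable 𝓘(ℂ, ℂ × ℂ) 𝓘(ℂ, ℂ)
      (fun x : WildSurface => fibreCoord x ^ 2 - wildFun (surfaceProj x)) := by
  intro x
  by_cases h : x.1.2 = 0
  · have hi : 0 < x.1.1.im := x.2.2.2.resolve_right (fun h' => h' h)
    refine MDifferentiableAt.comp x (g := fun p : ℂ × ℂ => p.2 ^ 2 - wildFun p.1)
      (I' := 𝓘(ℂ, ℂ × ℂ)) (DifferentiableAt.mdifferentiableAt ?_) (mdifferentiableAt_proj_coord hi)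
    exact (differentiableAt_snd.pow 2).sub ((contDiffAt_wildFun_fst hi).differentiableAt (by simp))
  · refine MDifferentiableAt.comp x (g := (Prod.snd : ℂ × ℂ → ℂ)) (I' := 𝓘(ℂ, ℂ × ℂ))
      (f := branchChart x.1.2) differentiableAt_snd.mdifferentiableAt
      (mdifferentiableAt_atlas (mem_insert_of_mem _ (mem_range_self _)) ?_)
    rw [branchChart_source, mem_ofPred_eq, div_self h]
    exact one_pos

end Surface

/-! ### The fibers, connectedness, and circles around the puncture. -/

section Fibres

open Complex Filter Topology

section Chart

variable {𝕜 : Type*} [NontriviallyNormedField 𝕜] {E F : Type*} [NormedAddCommGroup E]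
  [NormedSpace 𝕜 E] [NormedAddCommGroup F] [NormedSpace 𝕜 F] {H : Type*} [TopologicalSpace H]
  {I : ModelWithCorners 𝕜 F H} {M : Type*} [TopologicalSpace M] [ChartedSpace H M]
  {N : Type*} [TopologicalSpace N] [ChartedSpace E N]

/-- The derivative of a map can be computed in the preferred chart of the target. -/
theorem HasMFDerivAt.of_chartAt_comp {f : M → N} {x : M} {f' : F →L[𝕜] E} (hf : ContinuousAt f x)
    (h : HasMFDerivAt I 𝓘(𝕜, E) (chartAt E (f x) ∘ f) x f') : HasMFDerivAt I 𝓘(𝕜, E) f x f' := by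
  refine ⟨hf, ?_⟩
  -- Written in charts, `f` and its composition with the preferred chart are definitionally the same
  -- map.
  have h2 := h.2
  exact h2

end Chart

/-- The point of the surface with given coordinates. -/
noncomputable def surfacePoint : ℂ × ℂ → WildSurface := surfaceIncl.symm

theorem surfacePoint_val {p : ℂ × ℂ} (hp : p ∈ surfaceSet) : (surfacePoint p).1 = p :=
  surfaceIncl_symm_val hp

theorem surfacePoint_coe (x : WildSurface) : surfacePoint x.1 = x :=
  Subtype.ext (surfacePoint_val x.2)

theorem continuousOn_surfacePoint : ContinuousOn surfacePoint surfaceSet := by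
  have := surfaceIncl.continuousOn_symm
  rwa [surfaceIncl_target] at this

theorem continuousAt_surfacePoint {p : ℂ × ℂ} (hp : p ∈ surfaceSet) :
    ContinuousAt surfacePoint p :=
  continuousOn_surfacePoint.continuousAt (isOpen_surfaceSet.mem_nhds hp)

theorem fibreCoord_surfacePoint {p : ℂ × ℂ} (hp : p ∈ surfaceSet) :
    fibreCoord (surfacePoint p) = p.2 := congr_arg Prod.snd (surfacePoint_val hp)

theorem surfaceProj_surfacePoint {p : ℂ × ℂ} (hp : p ∈ surfaceSet) :
    surfaceProj (surfacePoint p) = p.1 := congr_arg Prod.fst (surfacePoint_val hp)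

theorem eq_surfacePoint {z : ℂ} {x : WildSurface} (hx : surfaceProj x = z) :
    x = surfacePoint (z, fibreCoord x) := by
  rw [← hx]
  exact (surfacePoint_coe x).symm

theorem fibreCoord_ne_zero {x : WildSurface} (hx : (surfaceProj x).im ≤ 0) : fibreCoord x ≠ 0 :=
  x.2.2.2.resolve_left (not_lt.2 hx)

theorem norm_fibreCoord_lt (x : WildSurface) : ‖fibreCoord x‖ < 1 := x.2.2.1

theorem norm_surfaceProj_lt (x : WildSurface) : ‖surfaceProj x‖ < 1 := x.2.1

theorem mem_surfaceSet_of_im_pos {z w : ℂ} (hz : ‖z‖ < 1) (hi : 0 < z.im) (hw : ‖w‖ < 1) :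
    (z, w) ∈ surfaceSet := ⟨hz, hw, Or.inl hi⟩

theorem mem_surfaceSet_of_ne_zero {z w : ℂ} (hz : ‖z‖ < 1) (hw : ‖w‖ < 1) (h0 : w ≠ 0) :
    (z, w) ∈ surfaceSet := ⟨hz, hw, Or.inr h0⟩

theorem exists_hasMFDerivAt_surfacePoint {z w : ℂ} (h : (z, w) ∈ surfaceSet) :
    ∃ f' : ℂ →L[ℂ] ℂ × ℂ, Function.Injective f' ∧
      HasMFDerivAt 𝓘(ℂ, ℂ) 𝓘(ℂ, ℂ × ℂ) (fun w => surfacePoint (z, w)) w f' := by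
  have hc : ContinuousAt (fun w => surfacePoint (z, w)) w :=
    ContinuousAt.comp (f := fun w => (z, w)) (continuousAt_surfacePoint h) (by fun_prop)
  have hev : ∀ᶠ v in 𝓝 w, (z, v) ∈ surfaceSet :=
    (Continuous.prodMk_right z).continuousAt.eventually (isOpen_surfaceSet.mem_nhds h)
  have hval : (surfacePoint (z, w)).1.2 = w := fibreCoord_surfacePoint h
  by_cases hw : w = 0
  · refine ⟨ContinuousLinearMap.inr ℂ ℂ ℂ, fun a b hab => (Prod.ext_iff.1 hab).2,
      HasMFDerivAt.of_chartAt_comp hc ?_⟩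
    rw [chartAt_of_eq_zero (hval.trans hw)]
    have h1 : HasFDerivAt (fun v => (z, v)) (ContinuousLinearMap.inr ℂ ℂ ℂ) w :=
      (hasFDerivAt_const z w).prodMk (hasFDerivAt_id w)
    refine h1.hasMFDerivAt.congr_of_eventuallyEq ?_
    filter_upwards [hev] with v hv
    exact surfacePoint_val hv
  · have h1 : HasFDerivAt (fun v => (z, v ^ 2 - wildFun z))
        ((0 : ℂ →L[ℂ] ℂ).prod ((1 : ℂ →L[ℂ] ℂ).smulRight (2 * w))) w := by
      refine (hasFDerivAt_const z w).prodMk (HasDerivAt.hasFDerivAt ?_)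
      simpa using (hasDerivAt_pow 2 w).sub_const (wildFun z)
    refine ⟨_, fun a b hab => ?_, HasMFDerivAt.of_chartAt_comp hc
      (h1.hasMFDerivAt.congr_of_eventuallyEq ?_)⟩
    · have h2 : a * (2 * w) = b * (2 * w) := by simpa using (Prod.ext_iff.1 hab).2
      exact mul_right_cancel₀ (mul_ne_zero two_ne_zero hw) h2
    · rw [chartAt_of_ne_zero (by rwa [hval])]
      filter_upwards [hev] with v hv
      change branchChart _ (surfacePoint (z, v)) = _
      rw [branchChart_apply, surfacePoint_val hv]

theorem isBiholomorphicOnto_surfacePoint {z : ℂ} {Ω : Set ℂ}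
    (hΩ : ∀ w, w ∈ Ω ↔ (z, w) ∈ surfaceSet) :
    IsBiholomorphicOnto (fun w => surfacePoint (z, w)) Ω (surfaceProj ⁻¹' {z}) := by
  have hd := fun w (hw : w ∈ Ω) => exists_hasMFDerivAt_surfacePoint ((hΩ w).1 hw)
  have hcont : ContinuousOn (fun w => surfacePoint (z, w)) Ω :=
    continuousOn_surfacePoint.comp (by fun_prop) (fun w hw => (hΩ w).1 hw)
  refine ⟨fun w hw => ?_, fun w hw => ?_, ?_, ?_⟩
  · obtain ⟨f', -, h⟩ := hd w hw
    exact h.mdifferentiableAt.mdifferentiableWithinAt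
  · obtain ⟨f', hinj, h⟩ := hd w hw
    rw [h.mfderiv]
    exact hinj
  -- `fibreCoord` is a continuous left inverse.
  · refine Topology.IsEmbedding.of_comp (g := fibreCoord) hcont.domRestrict
      continuous_fibreCoord ?_
    have : fibreCoord ∘ Ω.domRestrict (fun w => surfacePoint (z, w)) = Subtype.val := by
      funext w
      exact fibreCoord_surfacePoint ((hΩ w).1 w.2)
    rw [this]
    exact Topology.IsEmbedding.subtypeVal
  · ext x
    constructor
    · rintro ⟨w, hw, rfl⟩
      exact surfaceProj_surfacePoint ((hΩ w).1 hw)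
    · intro hx
      refine ⟨fibreCoord x, (hΩ _).2 ?_, (eq_surfacePoint hx).symm⟩
      rw [← show surfaceProj x = z from hx]
      exact x.2

theorem isBiholomorphicOnto_of_im_pos {z : ℂ} (hz : ‖z‖ < 1) (hi : 0 < z.im) :
    IsBiholomorphicOnto (fun w => surfacePoint (z, w)) (ball 0 1) (surfaceProj ⁻¹' {z}) :=
  isBiholomorphicOnto_surfacePoint fun w => by simp [surfaceSet, hz, hi]

theorem isBiholomorphicOnto_of_im_nonpos {z : ℂ} (hz : ‖z‖ < 1) (hi : z.im ≤ 0) :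
    IsBiholomorphicOnto (fun w => surfacePoint (z, w)) (ball 0 1 \ {0}) (surfaceProj ⁻¹' {z}) :=
  isBiholomorphicOnto_surfacePoint fun w => by simp [surfaceSet, hz, not_lt.2 hi]

theorem isDiskWithPunctures_fibre {z : ℂ} (hz : z ∈ ball (0 : ℂ) 1) :
    IsDiskWithPunctures (surfaceProj ⁻¹' {z}) := by
  rw [mem_ball_zero_iff] at hz
  rcases lt_or_ge 0 z.im with hi | hi
  · exact ⟨∅, finite_empty, empty_subset _, _, by
      rw [sdiff_empty]; exact isBiholomorphicOnto_of_im_pos hz hi⟩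
  · exact ⟨{0}, finite_singleton _, by simp, _, isBiholomorphicOnto_of_im_nonpos hz hi⟩

/-- Maps into a parametrized curve lift to the parameter domain. -/
theorem IsBiholomorphicOnto.exists_lift {X : Type*} [TopologicalSpace X] [ChartedSpace (ℂ × ℂ) X]
    {φ : ℂ → X} {Ω : Set ℂ} {Y : Set X} (hφ : IsBiholomorphicOnto φ Ω Y) {T : Type*}
    [TopologicalSpace T] {g : T → X} {S : Set T} (hg : ContinuousOn g S) (hY : MapsTo g S Y) :
    ∃ b : T → ℂ, ContinuousOn b S ∧ ∀ t ∈ S, b t ∈ Ω ∧ φ (b t) = g t := by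
  have h : ∀ t, ∃ w, t ∈ S → w ∈ Ω ∧ φ w = g t := by
    intro t
    by_cases ht : t ∈ S
    · have := hY ht
      rw [← hφ.image_eq] at this
      obtain ⟨w, hw, hwt⟩ := this
      exact ⟨w, fun _ => ⟨hw, hwt⟩⟩
    · exact ⟨0, fun h => absurd h ht⟩
  choose b hb using h
  refine ⟨b, ?_, hb⟩
  rw [continuousOn_iff_continuous_domRestrict]
  have : Continuous (fun t : S => (⟨b t, (hb t t.2).1⟩ : Ω)) := by
    rw [hφ.embedding.isInducing.continuous_iff]
    refine (continuousOn_iff_continuous_domRestrict.1 hg).congr fun t => ?_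
    exact (hb t t.2).2.symm
  exact continuous_subtype_val.comp this

theorem IsBiholomorphicOnto.injOn {X : Type*} [TopologicalSpace X] [ChartedSpace (ℂ × ℂ) X]
    {φ : ℂ → X} {Ω : Set ℂ} {Y : Set X} (hφ : IsBiholomorphicOnto φ Ω Y) : InjOn φ Ω :=
  injOn_iff_injective.2 hφ.embedding.injective

theorem not_hasLog_const_mul {a : ℂ} (ha : a ≠ 0) : ¬ HasLog (fun s : Circle => a * s) := by
  rintro ⟨l, hl, h⟩
  refine not_hasLog_coe ⟨fun s => l s - log a, hl.sub continuous_const, fun s => ?_⟩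
  rw [exp_sub, h, exp_log ha, mul_div_cancel_left₀ _ ha]

theorem half_mul_mem_surfaceSet {z : ℂ} (hz : ‖z‖ < 1) (s : Circle) :
    (z, (1 / 2 : ℂ) * s) ∈ surfaceSet := by
  refine mem_surfaceSet_of_ne_zero hz ?_ (mul_ne_zero (by norm_num) s.coe_ne_zero)
  rw [norm_mul, Circle.norm_coe]
  norm_num

/-- On a disk the zero-free function `w` would have a logarithm, hence also along the circle |w| =
1/2. -/
theorem not_isDisk_of_im_nonpos {z : ℂ} (hz : ‖z‖ < 1) (hi : z.im ≤ 0) :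
    ¬ IsDisk (surfaceProj ⁻¹' {z}) := by
  rintro ⟨φ, hφ⟩
  obtain ⟨b, hb, hbφ⟩ := hφ.exists_lift (T := Circle) (S := univ)
    (g := fun s => surfacePoint (z, (1 / 2 : ℂ) * s))
    (continuousOn_surfacePoint.comp (by fun_prop) (fun s _ => half_mul_mem_surfaceSet hz s))
    (fun s _ => surfaceProj_surfacePoint (half_mul_mem_surfaceSet hz s))
  have hcont : ContinuousOn (fun w => fibreCoord (φ w)) (ball 0 1) :=
    continuous_fibreCoord.comp_continuousOn hφ.holomorphic.continuousOn
  obtain ⟨l, hl, hle⟩ := (convex_ball (0 : ℂ) 1).exists_continuousOn_log hcont (fun w hw => by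
    refine fibreCoord_ne_zero ?_
    have : φ w ∈ surfaceProj ⁻¹' {z} := hφ.image_eq ▸ mem_image_of_mem φ hw
    rwa [show surfaceProj (φ w) = z from this])
  refine not_hasLog_const_mul (a := 1 / 2) (by norm_num) ⟨fun s => l (b s), ?_, fun s => ?_⟩
  · exact hl.comp_continuous (continuousOn_univ.1 hb) (fun s => (hbφ s trivial).1)
  · rw [hle _ (hbφ s trivial).1, (hbφ s trivial).2,
      fibreCoord_surfacePoint (half_mul_mem_surfaceSet hz s)]

theorem diskLocus_surfaceProj : diskLocus surfaceProj = ball 0 1 ∩ {z | 0 < z.im} := by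
  ext z
  constructor
  · rintro ⟨hz, hd⟩
    refine ⟨hz, ?_⟩
    by_contra h
    exact not_isDisk_of_im_nonpos (mem_ball_zero_iff.1 hz) (not_lt.1 h) hd
  · rintro ⟨hz, hi⟩
    exact ⟨hz, _, isBiholomorphicOnto_of_im_pos (mem_ball_zero_iff.1 hz) hi⟩

theorem isOpen_diskLocus : IsOpen (diskLocus surfaceProj) := by
  rw [diskLocus_surfaceProj]
  exact isOpen_ball.inter (isOpen_lt continuous_const continuous_im)

theorem zero_mem_closure_diskLocus : (0 : ℂ) ∈ closure (diskLocus surfaceProj) := by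
  rw [diskLocus_surfaceProj]
  refine isOpen_ball.inter_closure ⟨mem_ball_self one_pos, ?_⟩
  rw [Complex.closure_setOfPred_lt_im]
  exact le_refl (0 : ℝ)

theorem zero_mem_frontier_diskLocus : (0 : ℂ) ∈ frontier (diskLocus surfaceProj) := by
  rw [isOpen_diskLocus.frontier_eq]
  refine ⟨zero_mem_closure_diskLocus, fun h => ?_⟩
  rw [diskLocus_surfaceProj] at h
  simpa using h.2

theorem range_surfaceProj : range surfaceProj = ball 0 1 := by
  ext z
  rw [mem_ball_zero_iff]
  constructor
  · rintro ⟨x, rfl⟩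
    exact norm_surfaceProj_lt x
  · intro hz
    exact ⟨_, surfaceProj_surfacePoint (half_mul_mem_surfaceSet hz 1)⟩

theorem isPreconnected_puncturedBall : IsPreconnected (ball (0 : ℂ) 1 \ {0}) := by
  have : ball (0 : ℂ) 1 \ {0} = exp '' {z | z.re < 0} := by
    ext w
    rw [Set.mem_sdiff, mem_ball_zero_iff, mem_singleton_iff]
    constructor
    · rintro ⟨h1, h2⟩
      refine ⟨log w, ?_, exp_log h2⟩
      rw [mem_ofPred_eq, log_re]
      exact Real.log_neg (norm_pos_iff.2 h2) h1
    · rintro ⟨z, hz, rfl⟩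
      rw [norm_exp]
      exact ⟨Real.exp_lt_one_iff.2 hz, exp_ne_zero z⟩
  rw [this]
  exact (convex_halfSpace_re_lt 0).isPreconnected.image _ continuous_exp.continuousOn

/-- The points with w ≠ 0 form a connected product, which is dense. -/
instance : ConnectedSpace WildSurface := by
  refine isConnected_iff_connectedSpace.1 ⟨⟨_, half_mul_mem_surfaceSet (z := 0) (by simp) 1⟩, ?_⟩
  refine ((convex_ball (0 : ℂ) 1).isPreconnected.prod
    isPreconnected_puncturedBall).subset_closure ?_ ?_
  · rintro ⟨z, w⟩ ⟨hz, hw, hw0⟩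
    exact mem_surfaceSet_of_ne_zero (mem_ball_zero_iff.1 hz) (mem_ball_zero_iff.1 hw) hw0
  · rintro ⟨z, w⟩ ⟨hz, hw, -⟩
    rw [closure_prod_eq]
    refine ⟨subset_closure (mem_ball_zero_iff.2 hz), ?_⟩
    rw [sdiff_eq]
    refine (dense_compl_singleton (0 : ℂ)).open_subset_closure_inter isOpen_ball
      (mem_ball_zero_iff.2 hw)

/-- A circle around the puncture has no continuous logarithm of the fibre coordinate. -/
theorem IsCircleAroundPuncture.not_hasLog {γ : Circle → WildSurface}
    (h : IsCircleAroundPuncture (surfaceProj ⁻¹' {0}) γ) : ¬ HasLog (fun s => fibreCoord (γ s)) := by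
  obtain ⟨hγ, hinj, φ, hφ, c, hc, hbd⟩ := h
  rintro ⟨l, hl, hle⟩
  have hcc : Continuous c := by
    have : Continuous (fun s => (⟨c s, (hc s).1⟩ : (ball 0 1 \ {0} : Set ℂ))) := by
      rw [hφ.embedding.isInducing.continuous_iff]
      exact hγ.congr fun s => (hc s).2.symm
    exact continuous_subtype_val.comp this
  have hci : Function.Injective c := fun s t hst => hinj (by rw [← (hc s).2, hst, (hc t).2])
  refine not_hasLog_of_isBounded hcc hci (fun s => (hc s).1.2) hbd ?_
  -- The parametrization φ is arbitrary, so a logarithm of `w` must be turned into one of the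
  -- parameter `c`. The left half plane covers the fiber by `exp`; being convex, it carries a
  -- logarithm `L` of the lifted parameter, and `L ∘ l` is the one sought.
  have hmem : ∀ ζ ∈ {ζ : ℂ | ζ.re < 0}, ((0 : ℂ), exp ζ) ∈ surfaceSet := fun ζ hζ =>
    mem_surfaceSet_of_ne_zero (by simp) (by rw [norm_exp]; exact Real.exp_lt_one_iff.2 hζ) (exp_ne_zero _)
  obtain ⟨b, hb, hbφ⟩ := hφ.exists_lift (S := {ζ : ℂ | ζ.re < 0})
    (g := fun ζ => surfacePoint (0, exp ζ))
    (continuousOn_surfacePoint.comp (by fun_prop) hmem)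
    (fun ζ hζ => surfaceProj_surfacePoint (hmem ζ hζ))
  obtain ⟨L, hL, hLe⟩ := (convex_halfSpace_re_lt 0).exists_continuousOn_log hb
    (fun ζ hζ => (hbφ ζ hζ).1.2)
  have hls : ∀ s, l s ∈ {ζ : ℂ | ζ.re < 0} := fun s => by
    have h1 := norm_fibreCoord_lt (γ s)
    rw [← show exp (l s) = fibreCoord (γ s) from hle s, norm_exp, Real.exp_lt_one_iff] at h1
    exact h1
  refine ⟨fun s => L (l s), hL.comp_continuous hl hls, fun s => ?_⟩
  rw [hLe _ (hls s)]
  refine hφ.injOn (hbφ _ (hls s)).1 (hc s).1 ?_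
  rw [(hbφ _ (hls s)).2, (hc s).2, hle]
  refine (eq_surfacePoint ?_).symm
  have : φ (c s) ∈ surfaceProj ⁻¹' {0} := hφ.image_eq ▸ mem_image_of_mem φ (hc s).1
  rwa [(hc s).2] at this

end Fibres

/-! ### The smooth family of circles and the disks they bound. -/

section CircleFamily

open Complex Filter Topology ComplexConjugate

theorem norm_four_mul_wildFun_mul_le (z : ℂ) {t : ℂ} (ht : ‖t‖ ≤ 1) :
    ‖4 * wildFun z * t‖ ≤ 1 / 8 := by
  rw [norm_mul, norm_mul]
  have h := norm_wildFun_le z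
  have h4 : ‖(4 : ℂ)‖ = 4 := by norm_num
  rw [h4]
  have := mul_le_mul (mul_le_mul_of_nonneg_left h (by norm_num : (0 : ℝ) ≤ 4)) ht (norm_nonneg _)
    (by norm_num)
  linarith

/-- The factor turning `w / 2` into the fibre coordinate of the circles. -/
noncomputable def rootFactor (z t : ℂ) : ℂ := csqrt (1 + 4 * wildFun z * t)

theorem one_add_mem_slitPlane (z : ℂ) {t : ℂ} (ht : ‖t‖ ≤ 1) :
    1 + 4 * wildFun z * t ∈ slitPlane :=
  mem_slitPlane_of_norm_lt_one ((norm_four_mul_wildFun_mul_le z ht).trans_lt (by norm_num))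

theorem rootFactor_sq (z : ℂ) {t : ℂ} (ht : ‖t‖ ≤ 1) :
    rootFactor z t ^ 2 = 1 + 4 * wildFun z * t :=
  csqrt_sq (slitPlane_ne_zero (one_add_mem_slitPlane z ht))

theorem half_lt_rootFactor_re (z : ℂ) {t : ℂ} (ht : ‖t‖ ≤ 1) : 1 / 2 < (rootFactor z t).re := by
  have h0 : 0 < (rootFactor z t).re := csqrt_re_pos (one_add_mem_slitPlane z ht)
  have h1 := congr_arg re (rootFactor_sq z ht)
  have h2 := (abs_re_le_norm _).trans (norm_four_mul_wildFun_mul_le z ht)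
  rw [pow_two, mul_re, add_re, one_re] at h1
  have h3 := neg_le_of_abs_le h2
  nlinarith [mul_self_nonneg (rootFactor z t).im]

theorem norm_half_mul_rootFactor_lt (z : ℂ) {w t : ℂ} (hw : ‖w‖ ≤ 1) (ht : ‖t‖ ≤ 1) :
    ‖1 / 2 * w * rootFactor z t‖ < 1 := by
  have h1 : ‖rootFactor z t‖ ^ 2 ≤ 1 + 1 / 8 := by
    rw [← norm_pow, rootFactor_sq z ht]
    refine (norm_add_le _ _).trans ?_
    rw [norm_one]
    linarith [norm_four_mul_wildFun_mul_le z ht]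
  have h2 : ‖rootFactor z t‖ < 2 := by nlinarith [norm_nonneg (rootFactor z t)]
  rw [norm_mul, norm_mul]
  have h3 : ‖(1 / 2 : ℂ)‖ = 1 / 2 := by norm_num
  rw [h3]
  nlinarith [norm_nonneg w, norm_nonneg (rootFactor z t)]

theorem continuousOn_rootFactor : ContinuousOn (fun p : ℂ × ℂ => rootFactor p.1 p.2)
    {p | ‖p.2‖ ≤ 1} := by
  have := continuous_wildFun
  exact continuousOn_csqrt.comp (f := fun p : ℂ × ℂ => 1 + 4 * wildFun p.1 * p.2) (by fun_prop)
    (fun p hp => one_add_mem_slitPlane p.1 hp)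

theorem norm_inv_circle_sq_le (s : Circle) : ‖((s : ℂ)⁻¹ ^ 2)‖ ≤ 1 := by
  rw [norm_pow, norm_inv, Circle.norm_coe]
  norm_num

/-- The fibre coordinate of the circles `w ^ 2 - wildFun z = s ^ 2 / 4`. -/
noncomputable def circleCoord (z : ℂ) (s : Circle) : ℂ :=
  1 / 2 * s * rootFactor z ((s : ℂ)⁻¹ ^ 2)

theorem circleCoord_sq (z : ℂ) (s : Circle) :
    circleCoord z s ^ 2 - wildFun z = (s : ℂ) ^ 2 / 4 := by
  have := s.coe_ne_zero
  rw [circleCoord, mul_pow, rootFactor_sq z (norm_inv_circle_sq_le s)]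
  field_simp
  ring

theorem circleCoord_ne_zero (z : ℂ) (s : Circle) : circleCoord z s ≠ 0 :=
  mul_ne_zero (mul_ne_zero (by norm_num) s.coe_ne_zero) (csqrt_ne_zero _)

theorem continuous_circle_coe : Continuous (fun s : Circle => (s : ℂ)) :=
  continuous_subtype_val

theorem continuous_inv_circle_sq : Continuous (fun s : Circle => (s : ℂ)⁻¹ ^ 2) :=
  (continuous_circle_coe.inv₀ fun s => s.coe_ne_zero).pow 2

theorem continuous_circleCoord : Continuous (fun p : ℂ × Circle => circleCoord p.1 p.2) := by
  have h : Continuous (fun p : ℂ × Circle => rootFactor p.1 ((p.2 : ℂ)⁻¹ ^ 2)) :=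
    continuousOn_rootFactor.comp_continuous (f := fun p : ℂ × Circle => (p.1, (p.2 : ℂ)⁻¹ ^ 2))
      (continuous_fst.prodMk (continuous_inv_circle_sq.comp continuous_snd))
      (fun p => norm_inv_circle_sq_le p.2)
  exact (continuous_const.mul (continuous_circle_coe.comp continuous_snd)).mul h

theorem circleCoord_injective (z : ℂ) : Function.Injective (circleCoord z) := by
  intro s t h
  have h1 : (s : ℂ) ^ 2 = (t : ℂ) ^ 2 := by
    have h2 := circleCoord_sq z s
    rw [h, circleCoord_sq] at h2
    linear_combination -4 * h2
  have h2 : (s : ℂ)⁻¹ ^ 2 = (t : ℂ)⁻¹ ^ 2 := by rw [inv_pow, inv_pow, h1]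
  rw [circleCoord, circleCoord, h2] at h
  have h3 := mul_right_cancel₀ (csqrt_ne_zero _) h
  exact Circle.ext (mul_left_cancel₀ (by norm_num) h3)

theorem circleCoord_mem {z : ℂ} (hz : ‖z‖ < 1) (s : Circle) : (z, circleCoord z s) ∈ surfaceSet :=
  mem_surfaceSet_of_ne_zero hz
    (norm_half_mul_rootFactor_lt z (Circle.norm_coe s).le (norm_inv_circle_sq_le s))
    (circleCoord_ne_zero z s)

/-- The root factor has positive real part, hence a logarithm, so the circle winds like s/2. -/
theorem not_hasLog_circleCoord (z : ℂ) : ¬ HasLog (circleCoord z) := by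
  intro h
  have h2 : HasLog (fun s : Circle => rootFactor z ((s : ℂ)⁻¹ ^ 2)) := by
    refine hasLog_of_mem_slitPlane ?_ (fun s => ?_)
    · exact continuousOn_rootFactor.comp_continuous (f := fun s : Circle => (z, (s : ℂ)⁻¹ ^ 2))
        (continuous_const.prodMk continuous_inv_circle_sq) (fun s => norm_inv_circle_sq_le s)
    · exact Or.inl (lt_trans (by norm_num) (half_lt_rootFactor_re z (norm_inv_circle_sq_le s)))
  refine not_hasLog_const_mul (a := 1 / 2) (by norm_num) ?_
  have h3 := h.div h2
  have h4 : (fun s : Circle => circleCoord z s / rootFactor z ((s : ℂ)⁻¹ ^ 2)) =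
      fun s : Circle => (1 / 2 : ℂ) * s := by
    funext s
    exact mul_div_cancel_right₀ _ (csqrt_ne_zero _)
  rwa [h4] at h3

/-- The family of circles `w ^ 2 - wildFun z = s ^ 2 / 4` in the fibres. -/
noncomputable def circleFamily (z : ℂ) (s : Circle) : WildSurface :=
  surfacePoint (z, circleCoord z s)

theorem fibreCoord_circleFamily {z : ℂ} (hz : ‖z‖ < 1) (s : Circle) :
    fibreCoord (circleFamily z s) = circleCoord z s :=
  fibreCoord_surfacePoint (circleCoord_mem hz s)

theorem surfaceProj_circleFamily {z : ℂ} (hz : ‖z‖ < 1) (s : Circle) :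
    surfaceProj (circleFamily z s) = z :=
  surfaceProj_surfacePoint (circleCoord_mem hz s)

theorem circleFamily_injective {z : ℂ} (hz : ‖z‖ < 1) : Function.Injective (circleFamily z) := by
  intro s t h
  refine circleCoord_injective z ?_
  rw [← fibreCoord_circleFamily hz, h, fibreCoord_circleFamily hz]

theorem continuousAt_circleFamily {p : ℂ × Circle} (hp : ‖p.1‖ < 1) :
    ContinuousAt (fun p : ℂ × Circle => circleFamily p.1 p.2) p :=
  ContinuousAt.comp (f := fun p : ℂ × Circle => (p.1, circleCoord p.1 p.2))
    (continuousAt_surfacePoint (circleCoord_mem hp p.2))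
    (continuous_fst.prodMk continuous_circleCoord).continuousAt

theorem continuous_circleFamily {z : ℂ} (hz : ‖z‖ < 1) : Continuous (circleFamily z) :=
  continuous_iff_continuousAt.2 fun s =>
    ContinuousAt.comp (f := fun s : Circle => (z, s)) (continuousAt_circleFamily (p := (z, s)) hz)
      (by fun_prop)

/-- This is why the circles are defined by w² − Φ(z) = s²/4: in the charts `wildFun` disappears and
the family is polynomial in `s`. -/
theorem chartAt_circleFamily {z : ℂ} (hz : ‖z‖ < 1) (s : Circle) {z' : ℂ} (hz' : ‖z'‖ < 1)
    (s' : Circle) :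
    chartAt (ℂ × ℂ) (circleFamily z s) (circleFamily z' s') = (z', (s' : ℂ) ^ 2 / 4) := by
  rw [chartAt_of_ne_zero (by
    rw [show (circleFamily z s).1.2 = circleCoord z s from fibreCoord_circleFamily hz s]
    exact circleCoord_ne_zero z s), branchChart_apply]
  rw [show (circleFamily z' s').1 = _ from surfacePoint_val (circleCoord_mem hz' s'),
    circleCoord_sq]

theorem contMDiff_circle_coe : ContMDiff (𝓡 1) 𝓘(ℝ, ℂ) ∞ (fun s : Circle => (s : ℂ)) :=
  haveI : Fact (Module.finrank ℝ ℂ = 1 + 1) := finrank_real_complex_fact'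
  contMDiff_coe_sphere

theorem mfderiv_circle_coe_injective (s : Circle) :
    Function.Injective (mfderiv (𝓡 1) 𝓘(ℝ, ℂ) (fun s : Circle => (s : ℂ)) s) :=
  haveI : Fact (Module.finrank ℝ ℂ = 1 + 1) := finrank_real_complex_fact'
  injective_mvfderiv_subtypeVal_sphere (E := ℂ) (n := 1) s

theorem isSmoothCircleFamily_circleFamily : IsSmoothCircleFamily surfaceProj circleFamily := by
  refine ⟨?_, fun z hz => ?_⟩
  · rintro ⟨z, s⟩ ⟨hz, -⟩
    rw [mem_ball_zero_iff] at hz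
    refine ContMDiffAt.contMDiffWithinAt (contMDiffAt_iff_target.2
      ⟨continuousAt_circleFamily hz, ?_⟩)
    have h : ContMDiff (𝓘(ℝ, ℂ).prod (𝓡 1)) 𝓘(ℝ, ℂ × ℂ) ∞
        (fun p : ℂ × Circle => (p.1, (p.2 : ℂ) ^ 2 / 4)) := by
      refine contMDiff_fst.prodMk_space ?_
      exact ContDiff.comp_contMDiff (g := fun u : ℂ => u ^ 2 / 4)
        (f := fun p : ℂ × Circle => (p.2 : ℂ)) (by fun_prop)
        (contMDiff_circle_coe.comp contMDiff_snd)
    refine (h (z, s)).congr_of_eventuallyEq ?_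
    have : ∀ᶠ p : ℂ × Circle in 𝓝 (z, s), ‖p.1‖ < 1 :=
      (continuous_fst.norm.continuousAt (x := (z, s))).eventually_lt continuousAt_const hz
    filter_upwards [this] with p hp
    simpa using chartAt_circleFamily hz s hp p.2
  · rw [mem_ball_zero_iff] at hz
    refine ⟨surfaceProj_circleFamily hz, circleFamily_injective hz, fun s => ?_⟩
    have h1 : HasFDerivAt (𝕜 := ℝ) (fun u : ℂ => (z, u ^ 2 / 4))
        ((0 : ℂ →L[ℝ] ℂ).prod (((1 : ℂ →L[ℂ] ℂ).smulRight ((s : ℂ) / 2)).restrictScalars ℝ))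
        (s : ℂ) := by
      refine (hasFDerivAt_const z _).prodMk (HasFDerivAt.restrictScalars ℝ
        (HasDerivAt.hasFDerivAt ?_))
      refine ((hasDerivAt_pow 2 (s : ℂ)).div_const 4).congr_deriv ?_
      norm_num
      ring
    have h2 := (contMDiff_circle_coe.mdifferentiableAt (x := s) (by simp)).hasMFDerivAt
    have h3 := HasMFDerivAt.comp s h1.hasMFDerivAt h2
    have h4 : (chartAt (ℂ × ℂ) (circleFamily z s) ∘ circleFamily z) =
        (fun u : ℂ => (z, u ^ 2 / 4)) ∘ (fun s : Circle => (s : ℂ)) :=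
      funext fun t => chartAt_circleFamily hz s hz t
    rw [← h4] at h3
    rw [(HasMFDerivAt.of_chartAt_comp (continuous_circleFamily hz).continuousAt h3).mfderiv]
    intro a b hab
    refine mfderiv_circle_coe_injective s ?_
    have h5 : ∀ x y : ℂ, x * ((s : ℂ) / 2) = y * ((s : ℂ) / 2) → x = y := fun x y =>
      mul_right_cancel₀ (div_ne_zero s.coe_ne_zero two_ne_zero)
    exact h5 _ _ (Prod.ext_iff.1 hab).2

theorem circleFamily_zero (s : Circle) : circleFamily 0 s = surfacePoint (0, (1 / 2 : ℂ) * s) := by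
  rw [circleFamily, circleCoord, rootFactor, wildFun_zero, mul_zero, zero_mul, add_zero, csqrt_one,
    mul_one]

theorem isBounded_connectedComponentIn_half :
    Bornology.IsBounded (connectedComponentIn (range fun s : Circle => (1 / 2 : ℂ) * s)ᶜ 0) := by
  refine (isBounded_ball (x := (0 : ℂ)) (r := 1 / 2)).subset fun w hw => ?_
  have h0 : (0 : ℂ) ∈ connectedComponentIn (range fun s : Circle => (1 / 2 : ℂ) * s)ᶜ 0 := by
    refine mem_connectedComponentIn ?_
    rintro ⟨s, hs⟩
    exact mul_ne_zero (by norm_num) s.coe_ne_zero hs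
  rw [mem_ball_zero_iff]
  by_contra! h
  have := isPreconnected_connectedComponentIn.intermediate_value h0 hw continuous_norm.continuousOn
  obtain ⟨v, hv, hv2⟩ := this (show (1 / 2 : ℝ) ∈ Icc ‖(0 : ℂ)‖ ‖w‖ from
    ⟨by rw [norm_zero]; norm_num, h⟩)
  refine connectedComponentIn_subset _ _ hv ⟨⟨2 * v, mem_sphere_zero_iff_norm.2 ?_⟩, ?_⟩
  · rw [norm_mul, show ‖v‖ = 1 / 2 from hv2]
    norm_num
  · change 1 / 2 * (2 * v) = v
    ring

theorem isCircleAroundPuncture_circleFamily :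
    IsCircleAroundPuncture (surfaceProj ⁻¹' {0}) (circleFamily 0) := by
  have hz : ‖(0 : ℂ)‖ < 1 := by simp
  refine ⟨continuous_circleFamily hz, circleFamily_injective hz, _,
    isBiholomorphicOnto_of_im_nonpos hz le_rfl, fun s => (1 / 2 : ℂ) * s, fun s => ⟨⟨?_, ?_⟩, ?_⟩,
    isBounded_connectedComponentIn_half⟩
  · rw [mem_ball_zero_iff]
    exact (half_mul_mem_surfaceSet hz s).2.1
  · exact mul_ne_zero (by norm_num) s.coe_ne_zero
  · exact (circleFamily_zero s).symm

/-- On a curve bounding a disk nonvanishing functions have logarithms. -/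
theorem BoundsDisk.hasLog {X : Type*} [TopologicalSpace X] [T2Space X] {Y : Set X} {γ : Circle → X}
    (h : BoundsDisk Y γ) (hγ : Continuous γ) {w : X → ℂ} (hw : ContinuousOn w Y)
    (h0 : ∀ y ∈ Y, w y ≠ 0) : HasLog (fun s => w (γ s)) := by
  obtain ⟨D, hD, hinj, hY, him⟩ := h
  obtain ⟨L, hL, hLe⟩ := (convex_closedBall (0 : ℂ) 1).exists_continuousOn_log
    (hw.comp hD hY) (fun v hv => h0 _ (hY hv))
  have hex : ∀ s, ∃ v : closedBall (0 : ℂ) 1, D v = γ s := fun s => by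
    obtain ⟨v, hv, hvs⟩ : γ s ∈ D '' sphere 0 1 := him ▸ mem_range_self s
    exact ⟨⟨v, sphere_subset_closedBall hv⟩, hvs⟩
  choose σ hσ using hex
  have : CompactSpace (closedBall (0 : ℂ) 1) :=
    isCompact_iff_compactSpace.1 (isCompact_closedBall 0 1)
  have hemb : Topology.IsClosedEmbedding ((closedBall (0 : ℂ) 1).domRestrict D) :=
    hD.domRestrict.isClosedEmbedding (injOn_iff_injective.1 hinj)
  have hσc : Continuous σ := by
    rw [hemb.isInducing.continuous_iff]
    exact hγ.congr fun s => (hσ s).symm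
  refine ⟨fun s => L (σ s), hL.comp_continuous (continuous_subtype_val.comp hσc)
    (fun s => (σ s).2), fun s => ?_⟩
  rw [hLe _ (σ s).2]
  exact congr_arg w (hσ s)

theorem not_boundsDisk_circleFamily : ¬ BoundsDisk (surfaceProj ⁻¹' {0}) (circleFamily 0) := by
  intro h
  have hz : ‖(0 : ℂ)‖ < 1 := by simp
  have := h.hasLog (continuous_circleFamily hz) continuous_fibreCoord.continuousOn (fun y hy =>
    fibreCoord_ne_zero (by rw [show surfaceProj y = 0 from hy]; exact le_rfl))
  simp only [fibreCoord_circleFamily hz] at this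
  exact not_hasLog_circleCoord 0 this

/-- On the unit circle conj w = w⁻¹, so this map extends `circleCoord` to the disk without a pole.
As `wildFun` is small, it is a Lipschitz-small perturbation of w/2. -/
theorem injOn_mul_rootFactor (z : ℂ) :
    InjOn (fun w : ℂ => 1 / 2 * w * rootFactor z (conj w ^ 2)) (closedBall 0 1) := by
  intro v hv w hw h
  rw [mem_closedBall_zero_iff] at hv hw
  have hsq : ∀ {u : ℂ}, ‖u‖ ≤ 1 → ‖conj u ^ 2‖ ≤ 1 := fun {u} hu => by
    rw [norm_pow, norm_conj]
    exact pow_le_one₀ (norm_nonneg _) hu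
  have hv2 := half_lt_rootFactor_re z (hsq hv)
  have hw2 := half_lt_rootFactor_re z (hsq hw)
  have hv3 := rootFactor_sq z (hsq hv)
  have hw3 := rootFactor_sq z (hsq hw)
  simp only at h
  set p := rootFactor z (conj v ^ 2)
  set q := rootFactor z (conj w ^ 2)
  have h1 : (v - w) * p = w * (q - p) := by linear_combination 2 * h
  have h2 : (p - q) * (p + q) = 4 * wildFun z * (conj (v - w) * conj (v + w)) := by
    rw [map_sub, map_add]
    linear_combination hv3 - hw3
  have h3 : ‖p - q‖ * ‖p + q‖ ≤ 1 / 4 * ‖v - w‖ := by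
    rw [← norm_mul, h2, norm_mul, norm_mul, norm_mul, norm_conj, norm_conj]
    have h4 := norm_wildFun_le z
    have h5 : ‖v + w‖ ≤ 2 := (norm_add_le _ _).trans (by linarith)
    have h6 : ‖(4 : ℂ)‖ = 4 := by norm_num
    rw [h6]
    calc 4 * ‖wildFun z‖ * (‖v - w‖ * ‖v + w‖) ≤ 4 * (1 / 32) * (‖v - w‖ * 2) := by gcongr
      _ = 1 / 4 * ‖v - w‖ := by ring
  have h4 : 1 ≤ ‖p + q‖ := by
    refine le_trans ?_ (re_le_norm _)
    rw [add_re]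
    linarith
  have h5 : 1 / 2 ≤ ‖p‖ := hv2.le.trans (re_le_norm _)
  have h6 : ‖v - w‖ * ‖p‖ ≤ ‖p - q‖ := by
    rw [← norm_mul, h1, norm_mul, norm_sub_rev q p]
    exact mul_le_of_le_one_left (norm_nonneg _) hw
  have h7 : ‖v - w‖ ≤ 0 := by nlinarith [norm_nonneg (v - w), norm_nonneg (p - q)]
  exact sub_eq_zero.1 (norm_le_zero_iff.1 h7)

theorem boundsDisk_circleFamily {z : ℂ} (hz : ‖z‖ < 1) (hi : 0 < z.im) :
    BoundsDisk (surfaceProj ⁻¹' {z}) (circleFamily z) := by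
  have hsq : ∀ u ∈ closedBall (0 : ℂ) 1, ‖conj u ^ 2‖ ≤ 1 := fun u hu => by
    rw [norm_pow, norm_conj]
    exact pow_le_one₀ (norm_nonneg _) (mem_closedBall_zero_iff.1 hu)
  have hmem : ∀ w ∈ closedBall (0 : ℂ) 1,
      (z, 1 / 2 * w * rootFactor z (conj w ^ 2)) ∈ surfaceSet := fun w hw =>
    mem_surfaceSet_of_im_pos hz hi
      (norm_half_mul_rootFactor_lt z (mem_closedBall_zero_iff.1 hw) (hsq w hw))
  have hcirc : ∀ s : Circle, circleFamily z s =
      surfacePoint (z, 1 / 2 * (s : ℂ) * rootFactor z (conj (s : ℂ) ^ 2)) := fun s => by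
    rw [circleFamily, circleCoord, ← Circle.coe_inv, Circle.coe_inv_eq_conj]
  refine ⟨fun w => surfacePoint (z, 1 / 2 * w * rootFactor z (conj w ^ 2)), ?_, ?_, ?_, ?_⟩
  · refine continuousOn_surfacePoint.comp (continuousOn_const.prodMk
      ((by fun_prop : ContinuousOn (fun w : ℂ => 1 / 2 * w) (closedBall 0 1)).mul ?_)) hmem
    exact continuousOn_rootFactor.comp (f := fun w : ℂ => (z, conj w ^ 2))
      (continuousOn_const.prodMk (continuous_conj.pow 2).continuousOn) hsq
  · intro v hv w hw h
    refine injOn_mul_rootFactor z hv hw ?_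
    have := congr_arg fibreCoord h
    rwa [fibreCoord_surfacePoint (hmem v hv), fibreCoord_surfacePoint (hmem w hw)] at this
  · intro w hw
    exact surfaceProj_surfacePoint (hmem w hw)
  · ext x
    constructor
    · rintro ⟨w, hw, rfl⟩
      exact ⟨⟨w, hw⟩, hcirc _⟩
    · rintro ⟨s, rfl⟩
      exact ⟨s, by simp [Circle.norm_coe], (hcirc s).symm⟩

end CircleFamily

/-! ### From foliated maps to roots, and the nonexistence statements. -/

section Nonexistence

open Complex Filter Topology

theorem isOpen_hartogsFigure (ε : ℝ) : IsOpen (hartogsFigure ε) := by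
  have h1 : Continuous (fun p : ℂ × ℂ => ‖p.1‖) := continuous_fst.norm
  have h2 : Continuous (fun p : ℂ × ℂ => ‖p.2‖) := continuous_snd.norm
  exact ((isOpen_lt h1 continuous_const).inter (isOpen_lt h2 continuous_const)).union
    ((isOpen_lt h1 continuous_const).inter
      ((isOpen_lt continuous_const h2).inter (isOpen_lt h2 continuous_const)))

theorem HomologousIn.mem_left {X : Type*} [TopologicalSpace X] {Y : Set X} {γ γ' : Circle → X}
    (h : HomologousIn Y γ γ') (s : Circle) : γ s ∈ Y := by
  obtain ⟨g, -, hg, -⟩ := h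
  exact hg s ▸ (g s).2

variable {ε : ℝ} {f : ℂ × ℂ → WildSurface} {ζ : ℂ → ℂ}

/-- The radius 1 − ε/2 makes the closed annulus up to 1 lie inside the open annulus of the Hartogs
figure. -/
theorem isFoliatedRoot_of_isFoliated (hε : 0 < ε)
    (hf : MDifferentiableOn 𝓘(ℂ, ℂ × ℂ) 𝓘(ℂ, ℂ × ℂ) f (hartogsFigure ε))
    (hζ : DifferentiableOn ℂ ζ (ball 0 (1 + ε)))
    (hπ : ∀ p ∈ hartogsFigure ε, surfaceProj (f p) = ζ p.1) :
    IsFoliatedRoot (1 - ε / 2) (1 + ε) {s | 1 - ε < ‖s‖ ∧ ‖s‖ < 1 + ε} ζ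
      (fun p => fibreCoord (f p) ^ 2 - wildFun (surfaceProj (f p))) (fun p => fibreCoord (f p)) := by
  have hmem : ∀ p ∈ ball (0 : ℂ) (1 + ε) ×ˢ {s : ℂ | 1 - ε < ‖s‖ ∧ ‖s‖ < 1 + ε},
      p ∈ hartogsFigure ε := fun p hp => Or.inr ⟨mem_ball_zero_iff.1 hp.1, hp.2⟩
  have hat := fun p (hp : p ∈ hartogsFigure ε) =>
    hf.mdifferentiableAt ((isOpen_hartogsFigure ε).mem_nhds hp)
  refine ⟨by linarith, ?_, fun s h1 h2 => ⟨by linarith, by linarith⟩, hζ, fun p hp => ?_, ?_,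
    fun z hz s hs => ?_, fun z hz hi s hs => ?_, fun p hp => ?_⟩
  · exact (isOpen_lt continuous_const continuous_norm).inter
      (isOpen_lt continuous_norm continuous_const)
  · refine DifferentiableAt.differentiableWithinAt (mdifferentiableAt_iff_differentiableAt.1 ?_)
    exact MDifferentiableAt.comp p (mdifferentiable_sq_sub_wildFun (f p)) (hat p (hmem p hp))
  · exact continuous_fibreCoord.comp_continuousOn (hf.continuousOn.mono hmem)
  · rw [hπ _ (hmem (z, s) ⟨hz, hs⟩)]
    ring
  · refine fibreCoord_ne_zero ?_
    rwa [hπ _ (hmem (z, s) ⟨hz, hs⟩)]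
  · refine DifferentiableAt.differentiableWithinAt (mdifferentiableAt_iff_differentiableAt.1 ?_)
    have hp' := hmem p ⟨hp.1.1, hp.2⟩
    refine MDifferentiableAt.comp p (g := fibreCoord) (f := f) (mdifferentiableAt_fibreCoord ?_)
      (hat p hp')
    rw [hπ p hp']
    exact hp.1.2

theorem hasLog_of_isFoliated (hε : 0 < ε)
    (hf : MDifferentiableOn 𝓘(ℂ, ℂ × ℂ) 𝓘(ℂ, ℂ × ℂ) f (hartogsFigure ε))
    (hζ : DifferentiableOn ℂ ζ (ball 0 (1 + ε)))
    (hπ : ∀ p ∈ hartogsFigure ε, surfaceProj (f p) = ζ p.1) (h0 : 0 < (ζ 0).im)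
    (h1 : (ζ 1).im ≤ 0) : HasLog (fun s => fibreCoord (f (1, s))) := by
  have hB0 : (0 : ℂ) ∈ ball (0 : ℂ) (1 + ε) := mem_ball_self (by linarith)
  have hB1 : (1 : ℂ) ∈ ball (0 : ℂ) (1 + ε) := by
    rw [mem_ball_zero_iff, norm_one]
    linarith
  have hat := fun p (hp : p ∈ hartogsFigure ε) =>
    hf.mdifferentiableAt ((isOpen_hartogsFigure ε).mem_nhds hp)
  have hmem : ∀ z : ℂ, ‖z‖ < ε → ∀ s ∈ closedBall (0 : ℂ) 1, (z, s) ∈ hartogsFigure ε :=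
    fun z hz s hs => Or.inl ⟨hz, (mem_closedBall_zero_iff.1 hs).trans_lt (by linarith)⟩
  have hslice : ∀ {q : WildSurface → ℂ} {z : ℂ}, ‖z‖ < ε →
      (∀ s ∈ closedBall (0 : ℂ) 1, MDifferentiableAt 𝓘(ℂ, ℂ × ℂ) 𝓘(ℂ, ℂ) q (f (z, s))) →
      ExtendsAt (fun p => q (f p)) (1 - ε / 2) z := by
    intro q z hz hq
    refine ⟨fun s => q (f (z, s)), DifferentiableOn.diffContOnCl_ball (U := closedBall 0 1)
      (fun s hs => ?_) subset_rfl, fun s _ _ => rfl⟩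
    have h2 := MDifferentiableAt.comp (z, s) (hq s hs) (hat _ (hmem z hz s hs))
    have h3 : DifferentiableAt ℂ (fun s : ℂ => (z, s)) s := by fun_prop
    exact ((mdifferentiableAt_iff_differentiableAt.1 h2).comp s h3).differentiableWithinAt
  have hε0 : ∀ᶠ z in 𝓝 (0 : ℂ), ‖z‖ < ε :=
    continuous_norm.continuousAt.eventually_lt continuousAt_const (by simpa using hε)
  have hi0 : ∀ᶠ z in 𝓝 (0 : ℂ), 0 < (ζ z).im :=
    continuousAt_const.eventually_lt (continuous_im.continuousAt.comp
      (hζ.continuousOn.continuousAt (isOpen_ball.mem_nhds hB0))) h0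
  refine (isFoliatedRoot_of_isFoliated hε hf hζ hπ).hasLog hB0 hB1 h0 h1 ?_ ?_
  · filter_upwards [hε0] with z hz
    exact hslice hz fun s _ => mdifferentiable_sq_sub_wildFun _
  · filter_upwards [hε0, hi0] with z hz hi
    refine hslice hz fun s hs => mdifferentiableAt_fibreCoord ?_
    rwa [hπ _ (hmem z hz s hs)]

theorem not_isFoliatedHolomorphic_of_im_pos {γ : Circle → WildSurface}
    (hγ : ¬ HasLog (fun s => fibreCoord (γ s))) {a : ℂ} (ha : 0 < a.im) (hε : 0 < ε)
    (hf : IsFoliatedHolomorphic surfaceProj ε f) (h0 : f (0, 0) ∈ surfaceProj ⁻¹' {a}) :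
    ¬ HomologousIn (surfaceProj ⁻¹' {0}) (fun s : Circle => f (1, s)) γ := by
  intro hh
  obtain ⟨hf, ζ, hζ, -, hπ⟩ := hf
  have h00 : ((0 : ℂ), (0 : ℂ)) ∈ hartogsFigure ε :=
    Or.inl ⟨by simpa using hε, by rw [norm_zero]; linarith⟩
  have h11 : ((1 : ℂ), ((1 : Circle) : ℂ)) ∈ hartogsFigure ε :=
    Or.inr ⟨by rw [norm_one]; linarith, by rw [Circle.norm_coe]; linarith,
      by rw [Circle.norm_coe]; linarith⟩
  have hζ0 : ζ 0 = a := (hπ _ h00).symm.trans h0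
  have hζ1 : ζ 1 = 0 := (hπ _ h11).symm.trans (hh.mem_left 1)
  have := hasLog_of_isFoliated hε hf hζ hπ (by rwa [hζ0]) (by rw [hζ1]; exact le_rfl)
  refine hγ ((hh.hasLog_iff continuous_fibreCoord.continuousOn fun y hy => ?_).1 this)
  refine fibreCoord_ne_zero ?_
  rw [show surfaceProj y = 0 from hy]
  exact le_rfl

/-- Over such a point the disk f(0, ·) avoids w = 0, so `w` has a logarithm on its boundary but none
on the circle. -/
theorem not_homologousIn_circleFamily_of_im_nonpos {a : ℂ} (ha : ‖a‖ < 1) (hi : a.im ≤ 0)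
    (hε : 0 < ε) (hf : IsFoliatedHolomorphic surfaceProj ε f)
    (h0 : f (0, 0) ∈ surfaceProj ⁻¹' {a}) :
    ¬ HomologousIn (surfaceProj ⁻¹' {a}) (fun s : Circle => f (0, s)) (circleFamily a) := by
  intro hh
  obtain ⟨hf, ζ, hζ, -, hπ⟩ := hf
  have hmem : ∀ w ∈ closedBall (0 : ℂ) 1, ((0 : ℂ), w) ∈ hartogsFigure ε := fun w hw =>
    Or.inl ⟨by simpa using hε, (mem_closedBall_zero_iff.1 hw).trans_lt (by linarith)⟩
  have hζ0 : ζ 0 = a := (hπ _ (hmem 0 (by simp))).symm.trans h0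
  have h1 : HasLog (fun s : Circle => fibreCoord (f (0, s))) := by
    refine hasLog_of_closedBall (F := fun w => fibreCoord (f (0, w)))
      (continuous_fibreCoord.comp_continuousOn (hf.continuousOn.comp (by fun_prop) hmem))
      (fun w hw => fibreCoord_ne_zero ?_)
    rwa [hπ _ (hmem w hw), hζ0]
  have h2 := (hh.hasLog_iff continuous_fibreCoord.continuousOn fun y hy =>
    fibreCoord_ne_zero (by rwa [show surfaceProj y = a from hy])).1 h1
  simp only [fibreCoord_circleFamily ha] at h2
  exact not_hasLog_circleCoord a h2

end Nonexistence

/-! ### The main theorem. -/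

theorem mainTheorem1 :
    ∃ (X : Type) (_ : TopologicalSpace X) (_ : T2Space X) (_ : SecondCountableTopology X)
      (_ : ConnectedSpace X) (_ : ChartedSpace (ℂ × ℂ) X) (_ : IsManifold 𝓘(ℂ, ℂ × ℂ) ω X)
      (π : X → ℂ),
      Manifold.IsSubmersion 𝓘(ℂ, ℂ × ℂ) 𝓘(ℂ, ℂ) ω π ∧
      range π = ball 0 1 ∧
      -- the fibers
      (∀ z ∈ ball (0 : ℂ) 1, IsDiskWithPunctures (π ⁻¹' {z})) ∧
      IsPuncturedDisk (π ⁻¹' {0}) ∧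
      (diskLocus π).Nonempty ∧ IsOpen (diskLocus π) ∧ (0 : ℂ) ∈ frontier (diskLocus π) ∧
      -- no foliated holomorphic map with the prescribed boundary behaviour
      (∀ γ₀ : Circle → X, IsCircleAroundPuncture (π ⁻¹' {0}) γ₀ →
        ∀ a ∈ diskLocus π, ∀ ε : ℝ, 0 < ε → ε < 1 →
          ¬ ∃ f : ℂ × ℂ → X, IsFoliatedHolomorphic π ε f ∧
            (∀ w ∈ ball (0 : ℂ) 1, f (0, w) ∈ π ⁻¹' {a}) ∧
            HomologousIn (π ⁻¹' {0}) (fun s : Circle => f (1, s)) γ₀) ∧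
      -- the negative answer to the question about smooth families of circles in the fibers
      (∃ Γ : ℂ → Circle → X, IsSmoothCircleFamily π Γ ∧
        IsCircleAroundPuncture (π ⁻¹' {0}) (Γ 0) ∧
        ¬ BoundsDisk (π ⁻¹' {0}) (Γ 0) ∧
        (∀ z ∈ diskLocus π, BoundsDisk (π ⁻¹' {z}) (Γ z)) ∧
        ∀ ε : ℝ, 0 < ε → ε < 1 →
          ¬ ∃ (f : ℂ × ℂ → X) (a : ℂ), a ∈ ball (0 : ℂ) 1 ∧ IsFoliatedHolomorphic π ε f ∧
            (∀ w ∈ ball (0 : ℂ) 1, f (0, w) ∈ π ⁻¹' {a}) ∧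
            HomologousIn (π ⁻¹' {a}) (fun s : Circle => f (0, s)) (Γ a) ∧
            HomologousIn (π ⁻¹' {0}) (fun s : Circle => f (1, s)) (Γ 0)) := by
  have hz : ‖(0 : ℂ)‖ < 1 := by simp
  refine ⟨WildSurface, inferInstance, inferInstance, inferInstance, inferInstance, inferInstance,
    inferInstance, surfaceProj, isSubmersion_surfaceProj, range_surfaceProj,
    fun z hz => isDiskWithPunctures_fibre hz, ⟨_, isBiholomorphicOnto_of_im_nonpos hz le_rfl⟩,
    closure_nonempty_iff.1 ⟨0, zero_mem_closure_diskLocus⟩, isOpen_diskLocus,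
    zero_mem_frontier_diskLocus, ?_, circleFamily, isSmoothCircleFamily_circleFamily,
    isCircleAroundPuncture_circleFamily, not_boundsDisk_circleFamily, ?_, ?_⟩
  · rintro γ₀ hγ₀ a ha ε hε - ⟨f, hf, h0, h1⟩
    rw [diskLocus_surfaceProj] at ha
    exact not_isFoliatedHolomorphic_of_im_pos hγ₀.not_hasLog ha.2 hε hf
      (h0 0 (mem_ball_self one_pos)) h1
  · intro z hz
    rw [diskLocus_surfaceProj] at hz
    exact boundsDisk_circleFamily (mem_ball_zero_iff.1 hz.1) hz.2
  · rintro ε hε - ⟨f, a, ha, hf, h0, h1, h2⟩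
    -- Over the upper half plane the condition at 0 fails; over the closed lower half plane already
    -- the condition at `a` does.
    rcases lt_or_ge 0 a.im with hi | hi
    · exact not_isFoliatedHolomorphic_of_im_pos isCircleAroundPuncture_circleFamily.not_hasLog hi hε
        hf (h0 0 (mem_ball_self one_pos)) h2
    · exact not_homologousIn_circleFamily_of_im_nonpos (mem_ball_zero_iff.1 ha) hi hε hf
        (h0 0 (mem_ball_self one_pos)) h1
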